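/- Let $n\ge 1$, let $f:\mathbb R^n\to\mathbb R^n$ and $B:\mathbb R^n\to\mathbb R^{n\times n}$, let $u_-\in\mathbb R^n$ and $T>0$, and let $\bar u:\mathbb R\to\mathbb R^n$ be a nonconstant $T$-periodic solution of $u'=B(u)^{-1}(f(u)-f(u_-))$, i.e. a stationary periodic wave of $u_t+f(u)_x=(B(u)u_x)_x$. Put $u_0:=\bar u(0)$. For parameters $(v,a,s)\in\mathbb R^n\times\mathbb R^n\times\mathbb R$ near $(u_-,u_0,0)$ let $\bar u^{(v,a,s)}$ be the solution on $[0,T]$ of $$u'=B(u)^{-1}\big(f(u)-f(v)-s(u-v)\big),\qquad u(0)=a,$$ write $[g]:=g(T)-g(0)$, and let $d(v,a,s):=[\bar u^{(v,a,s)}]$. Assume: (H0) $f,B\in C^2$; (H1) for every $x$, all eigenvalues of $B(\bar u(x))$ have positive real part; (H2) $df(u_-)$ is invertible; (H3) $\bar u$ is transversal: the derivative of $(a,s)\mapsto d(u_-,a,s)$ at $(u_0,0)$ has full rank $n$. *The coefficients.* Choose a basis $b_1=\bar u'(0),b_2,\dots,b_n$ of $\mathbb R^n$. With all derivatives taken at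 $(u_-,u_0,0)$, let $\tilde z_1:=-\partial\bar u/\partial s$, $w_j:=(\partial\bar u/\partial a)\,b_j$ for $2\le j\le n$, and $w_{n+j}:=(\partial\bar u/\partial v)\,e_j$ for $1\le j\le n$, where $e_j$ is the standard basis. Let $$\gamma:=\det\big([\tilde z_1],[w_2],\dots,[w_n]\big),$$ the determinant being computed in the coordinates of the basis $(b_j)$. By (H3), $\gamma\neq0$, so for $1\le j\le n$ there is a unique $\tilde w_{n+j}\in w_{n+j}+\mathrm{Span}(\tilde z_1,w_2,\dots,w_n)$ with $[\tilde w_{n+j}]=0$. Let $$\Delta:=\det\Big(\int_0^T\tilde w_{n+1}\,dx,\dots,\int_0^T\tilde w_{2n}\,dx\Big).$$ Equivalently $\Delta=\det(\partial\bar u_m/\partial u_-)$, where $\bar u_m(v):=\int_0^T\bar u^{(v,a(v),s(v))}\,dx$ and $v\mapsto(a(v),s(v))$ is the family, defined for $v$ near $u_-$, continuous at $u_-$ and with value $(u_0,0)$ there, such that $d(v,a(v),s(v))=0$ and the $b_1$-coordinate of $a(v)$ equals that of $u_0$; such a family exists. *The Evans function.* Let $B(x):=B(\bar u(x))$ and $A(x)w:=df(\bar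 u(x))w-\big(dB(\bar u(x))w\big)\bar u'(x)$. For $\lambda\in\mathbb C$ let $\Psi(\cdot,\lambda)$ be the fundamental matrix, $\Psi(0,\lambda)=I$, of the eigenvalue equation $(Bw')'=(Aw)'+\lambda w$ written as a first-order system for $(w,w')$, and let $D(k,\lambda):=\det\big(\Psi(T,\lambda)-e^{ikT}I\big)$. **Conclusion.** The function $D(0,\cdot)$ is analytic at $0$ and, as $\lambda\to0$ in $\mathbb C$, $$D(0,\lambda)=\lambda^{n+1}(-1)^n\det\big(df(u_-)^{-1}\big)\,\gamma\,\Delta+O(\lambda^{n+2}).$$ Equivalently, $(\partial/\partial\lambda)^kD(0,0)=0$ for $0\le k\le n$, and $$(\partial/\partial\lambda)^{n+1}D(0,0)=(-1)^n(n+1)!\,\det\big(df(u_-)^{-1}\big)\,\gamma\,\Delta.$$ -/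

import Mathlib

open Matrix Set Filter Topology Asymptotics

noncomputable section

namespace PeriodicWave

/-- The state space `ℝⁿ`. -/
abbrev State (n : ℕ) : Type := Fin n → ℝ

variable {n : ℕ}

/-- The Jacobian matrix `dg(u)`, with entries `∂gᵢ/∂uⱼ`. -/
def jacobian (g : State n → State n) (u : State n) : Matrix (Fin n) (Fin n) ℝ :=
  Matrix.of fun i j => fderiv ℝ g u (Pi.single j 1) i

/-! ### The traveling-wave equation and its solutions -/

/-- The right-hand side `B(u)⁻¹ (f(u) - f(u₋) - s (u - u₋))` of the traveling-wave equation. -/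
def field (f : State n → State n) (B : State n → Matrix (Fin n) (Fin n) ℝ)
    (um : State n) (s : ℝ) (u : State n) : State n :=
  (B u)⁻¹ *ᵥ (f u - f um - s • (u - um))

/-- `u` solves the traveling-wave equation with parameters `(u₋, s)` on `[0, T]`, `u(0) = u₀`. -/
def IsSolution (f : State n → State n) (B : State n → Matrix (Fin n) (Fin n) ℝ) (T : ℝ)
    (um u0 : State n) (s : ℝ) (u : ℝ → State n) : Prop :=
  u 0 = u0 ∧ ∀ x ∈ Icc 0 T, HasDerivWithinAt u (field f B um s (u x)) (Icc 0 T) x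

open Classical in
/-- The solution `ū^{(u₋,u₀,s)}` of the traveling-wave equation on `[0, T]` (and `0` if there is
none). Near the parameters of a given wave along which `B` is invertible, the solution on `[0, T]`
exists and is unique, so only its values outside `[0, T]`, which are never used, are arbitrary. -/
def profile (f : State n → State n) (B : State n → Matrix (Fin n) (Fin n) ℝ) (T : ℝ)
    (um u0 : State n) (s : ℝ) : ℝ → State n :=
  if h : ∃ u, IsSolution f B T um u0 s u then h.choose else 0

/-- The jump `[g] = g(T) - g(0)`. -/
def jump (T : ℝ) (g : ℝ → State n) : State n := g T - g 0

/-- The special separation function `d(u₋,u₀,s)`. -/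
def separation (f : State n → State n) (B : State n → Matrix (Fin n) (Fin n) ℝ) (T : ℝ)
    (um u0 : State n) (s : ℝ) : State n :=
  jump T (profile f B T um u0 s)

/-- The variation `(∂ū/∂u₀) h` at the parameters `(u₋, u₀, 0)`. -/
def varInit (f : State n → State n) (B : State n → Matrix (Fin n) (Fin n) ℝ) (T : ℝ)
    (um u0 : State n) (h : State n) (x : ℝ) : State n :=
  fderiv ℝ (fun v => profile f B T um v 0 x) u0 h

/-- The variation `z̃₁ = -∂ū/∂s` at the parameters `(u₋, u₀, 0)`. -/
def varSpeed (f : State n → State n) (B : State n → Matrix (Fin n) (Fin n) ℝ) (T : ℝ)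
    (um u0 : State n) (x : ℝ) : State n :=
  -deriv (fun s => profile f B T um u0 s x) 0

/-- The variation `(∂ū/∂u₋) h` at the parameters `(u₋, u₀, 0)`. -/
def varRest (f : State n → State n) (B : State n → Matrix (Fin n) (Fin n) ℝ) (T : ℝ)
    (um u0 : State n) (h : State n) (x : ℝ) : State n :=
  fderiv ℝ (fun v => profile f B T v u0 0 x) um h

/-- Transversality: the derivative of the separation function `d` with respect to `(u₀, s)` at
`(u₋, u₀, 0)` has full rank, i.e. is onto `ℝⁿ`. -/
def Transversal (f : State n → State n) (B : State n → Matrix (Fin n) (Fin n) ℝ) (T : ℝ)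
    (um u0 : State n) : Prop :=
  Function.Surjective
    (fderiv ℝ (fun p : State n × ℝ => separation f B T um p.1 p.2) (u0, 0))

/-! ### The coefficients `γ` and `Δ`

`b` is the basis that gives the coordinates in which `γ` is computed, with `b 0 = ū'(0)`. -/

/-- The `n` functions `z̃₁, w₂, …, wₙ`, where `wⱼ = (∂ū/∂u₀) bⱼ`. -/
def transverse [NeZero n] (f : State n → State n) (B : State n → Matrix (Fin n) (Fin n) ℝ) (T : ℝ)
    (um u0 : State n) (b : Module.Basis (Fin n) ℝ (State n)) (i : Fin n) : ℝ → State n :=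
  if i = 0 then varSpeed f B T um u0 else varInit f B T um u0 (b i)

/-- `γ = det([z̃₁], [w₂], …, [wₙ])`, the determinant being taken in the coordinates of `b`. -/
def gammaCoeff [NeZero n] (f : State n → State n) (B : State n → Matrix (Fin n) (Fin n) ℝ) (T : ℝ)
    (um u0 : State n) (b : Module.Basis (Fin n) ℝ (State n)) : ℝ :=
  b.det fun i => jump T (transverse f B T um u0 b i)

/-- The matrix with columns `[z̃₁], [w₂], …, [wₙ]` in standard coordinates. -/
def transverseMatrix [NeZero n] (f : State n → State n) (B : State n → Matrix (Fin n) (Fin n) ℝ)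
    (T : ℝ) (um u0 : State n) (b : Module.Basis (Fin n) ℝ (State n)) :
    Matrix (Fin n) (Fin n) ℝ :=
  Matrix.of fun i k => jump T (transverse f B T um u0 b k) i

/-- The adjusted variation `w̃_{n+j}`: the element of
`(∂ū/∂u₋) eⱼ + span (z̃₁, w₂, …, wₙ)` with zero jump. It is unique when `γ ≠ 0`, and its
coefficients are then found by inverting the matrix `([z̃₁], [w₂], …, [wₙ])`. -/
def adjusted [NeZero n] (f : State n → State n) (B : State n → Matrix (Fin n) (Fin n) ℝ) (T : ℝ)
    (um u0 : State n) (b : Module.Basis (Fin n) ℝ (State n)) (j : Fin n) (x : ℝ) : State n :=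
  varRest f B T um u0 (Pi.single j 1) x -
    ∑ k, ((transverseMatrix f B T um u0 b)⁻¹ *ᵥ
      jump T (varRest f B T um u0 (Pi.single j 1))) k • transverse f B T um u0 b k x

/-- `Δ = det(∫₀ᵀ w̃_{n+1}, …, ∫₀ᵀ w̃_{2n})`. -/
def deltaCoeff [NeZero n] (f : State n → State n) (B : State n → Matrix (Fin n) (Fin n) ℝ) (T : ℝ)
    (um u0 : State n) (b : Module.Basis (Fin n) ℝ (State n)) : ℝ :=
  (Matrix.of fun i j : Fin n => (∫ x in (0 : ℝ)..T, adjusted f B T um u0 b j x) i).det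

/-- `σ` is the family `u₋ ↦ (u₀, s)`, for `u₋` near `um`, of parameters of the `T`-periodic
solutions near the wave with parameters `(um, u0, 0)`, the phase being fixed by keeping the
`b 0`-coordinate of `u₀` at the value that it has at the given wave. -/
def IsPeriodicFamily [NeZero n] (f : State n → State n) (B : State n → Matrix (Fin n) (Fin n) ℝ)
    (T : ℝ) (um u0 : State n) (b : Module.Basis (Fin n) ℝ (State n))
    (σ : State n → State n × ℝ) : Prop :=
  σ um = (u0, 0) ∧ ContinuousAt σ um ∧
    ∀ᶠ v in 𝓝 um, separation f B T v (σ v).1 (σ v).2 = 0 ∧ b.repr (σ v).1 0 = b.repr u0 0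

/-- The mass over one period `ū_m(u₋) = ∫₀ᵀ ū^{(u₋,u₀,s)}` along a family `u₋ ↦ (u₀, s)`. -/
def mass (f : State n → State n) (B : State n → Matrix (Fin n) (Fin n) ℝ) (T : ℝ)
    (σ : State n → State n × ℝ) (v : State n) : State n :=
  ∫ x in (0 : ℝ)..T, profile f B T v (σ v).1 (σ v).2 x

/-! ### The linearized operator and the Evans function -/

/-- The matrix `A(x)` given by `A v = df(ū) v - (dB(ū) v) ū'`, so that the linearization of
`u_t + f(u)_x = (B(u) u_x)_x` about `ū` is `v_t = (B v_x)_x - (A v)_x`, with `B = B(ū(x))`. -/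
def coeffA (f : State n → State n) (B : State n → Matrix (Fin n) (Fin n) ℝ) (ub : ℝ → State n)
    (x : ℝ) : Matrix (Fin n) (Fin n) ℝ :=
  Matrix.of fun i j => jacobian f (ub x) i j -
    ∑ k, fderiv ℝ (fun v => B v i k) (ub x) (Pi.single j 1) * deriv ub x k

/-- The entrywise derivative of a matrix-valued function. -/
def matDeriv (M : ℝ → Matrix (Fin n) (Fin n) ℝ) (x : ℝ) : Matrix (Fin n) (Fin n) ℝ :=
  Matrix.of fun i j => deriv (fun y => M y i j) x

/-- A real matrix viewed as a complex one. -/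
def cplx (M : Matrix (Fin n) (Fin n) ℝ) : Matrix (Fin n) (Fin n) ℂ := M.map Complex.ofReal

/-- The coefficient matrix `[[0, I], [B⁻¹(λI + A'), B⁻¹(A - B')]]` of the eigenvalue equation
`(B w')' = (A w)' + λ w`, written as a first-order system for `W = (w, w')`. -/
def firstOrderCoeff (f : State n → State n) (B : State n → Matrix (Fin n) (Fin n) ℝ)
    (ub : ℝ → State n) (l : ℂ) (x : ℝ) : Matrix (Fin n ⊕ Fin n) (Fin n ⊕ Fin n) ℂ :=
  Matrix.fromBlocks 0 1
    ((cplx (B (ub x)))⁻¹ * (l • 1 + cplx (matDeriv (coeffA f B ub) x)))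
    ((cplx (B (ub x)))⁻¹ *
      (cplx (coeffA f B ub x) - cplx (matDeriv (fun y => B (ub y)) x)))

/-- `Ψ` is the fundamental solution of `W' = 𝔸(x) W` with `Ψ(0) = I`. -/
def IsFundamental {ι : Type} [Fintype ι] [DecidableEq ι] (𝔸 Ψ : ℝ → Matrix ι ι ℂ) : Prop :=
  Ψ 0 = 1 ∧ ∀ x i j, HasDerivAt (fun y => Ψ y i j) ((𝔸 x * Ψ x) i j) x

open Classical in
/-- The fundamental solution of `W' = 𝔸(x) W`; it exists and is unique when `𝔸` is continuous
(and it is set to `0` if there is none). -/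
def fundamental {ι : Type} [Fintype ι] [DecidableEq ι] (𝔸 : ℝ → Matrix ι ι ℂ) :
    ℝ → Matrix ι ι ℂ :=
  if h : ∃ Ψ, IsFundamental 𝔸 Ψ then h.choose else 0

/-- The monodromy matrix `M(λ) = Ψ(T, λ)`. -/
def monodromy (f : State n → State n) (B : State n → Matrix (Fin n) (Fin n) ℝ)
    (ub : ℝ → State n) (T : ℝ) (l : ℂ) : Matrix (Fin n ⊕ Fin n) (Fin n ⊕ Fin n) ℂ :=
  fundamental (firstOrderCoeff f B ub l) T

/-- The periodic Evans function `D(k, λ) = det (M(λ) - e^{ikT})`. -/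
def evans (f : State n → State n) (B : State n → Matrix (Fin n) (Fin n) ℝ)
    (ub : ℝ → State n) (T : ℝ) (k : ℝ) (l : ℂ) : ℂ :=
  (monodromy f B ub T l - Complex.exp (Complex.I * k * T) • 1).det

/-- The coefficient `(-1)ⁿ det(df(u₋)⁻¹) γ Δ`. -/
def leadingCoeff [NeZero n] (f : State n → State n) (B : State n → Matrix (Fin n) (Fin n) ℝ)
    (T : ℝ) (um u0 : State n) (b : Module.Basis (Fin n) ℝ (State n)) : ℝ :=
  (-1) ^ n * ((jacobian f um)⁻¹).det * gammaCoeff f B T um u0 b * deltaCoeff f B T um u0 b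

end PeriodicWave

end

/-!
# The Evans function of a periodic wave at the origin

The eigenvalue equation `(B w')' = (A w)' + l w` becomes, in the variables `(w, q)` with
`q = B w' - A w`, the system `w' = B⁻¹ (A w + q)`, `q' = l w`. The change of variables is
`T`-periodic, so `D(0, l)` is the determinant of `Φ(T) - 1` for the fundamental matrix `Φ` of the
new system (`IsRegularWave.exists_evans_eq`), and multiplying by a matrix of initial values turns
it into the determinant of the jumps over a period of `2n` solutions.

Differentiating `B(u) u' = f(u) - f(u₋) - s (u - u₋)` in the parameters shows that a variation `w`
of the profile solves the system at `l = 0` with flux `q = -df(u₋) δu₋ - δs (u - u₋)`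
(`IsRegularWave.fderiv_field`). Thus `w₂, …, w₂ₙ` have constant flux, and `z̃₁ = -∂u/∂s` has flux
`u - u₋`, whose derivative `u'` makes `u' + l z̃₁` a solution to first order in `l`. Each
variation is continued to a family of solutions, entire in `l` (`IsContinuation`,
`system_differentiable`). In the determinant of the jumps, the first column `u' + l V` contributes
a factor `l` because `u'` is periodic, and the `n` rows of flux contribute `l ^ n` because
`q' = l w` gives `[q] = l ∫ w`. This is the exact factorization `evans_mul_det`. The remaining
factor is entire, and at `l = 0` it is the determinant of the jumps and integrals of the
variations; eliminating the jumps of `wₙ₊₁, …, w₂ₙ` (Schur complement) evaluates it as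
`det b · γ · Δ` (`det_jumpIntegralMatrix_zero`).

The profile is differentiated by regarding the parameters as part of the initial value
(`extendedField`). Near the wave, the field is replaced by a compactly supported one, whose
solutions exist on all of `[0, T]`, and Grönwall's inequality gives strict differentiability in
the initial value, uniformly over `[0, T]` (`exists_flow`, `IsRegularWave.exists_isVariation`).
Strictness is what the implicit function theorem needs in order to produce the family of periodic
waves (`IsVariation.exists_family`), and uniformity is what differentiating the mass needs.
-/

/-! ### Linear differential equations and Grönwall bounds -/

section ODE

theorem continuous_mulVecCLM {𝕜 ι : Type*} [RCLike 𝕜] [Fintype ι]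
    {A : ℝ → Matrix ι ι 𝕜} (hA : Continuous A) :
    Continuous fun t => LinearMap.toContinuousLinearMap (A t).mulVecLin := by
  classical
  let L : Matrix ι ι 𝕜 →ₗ[𝕜] ((ι → 𝕜) →L[𝕜] (ι → 𝕜)) :=
    (LinearMap.toContinuousLinearMap (𝕜 := 𝕜) (E := ι → 𝕜) (F' := ι → 𝕜)).toLinearMap ∘ₗ
      (Matrix.toLin' (R := 𝕜) (m := ι) (n := ι)).toLinearMap
  exact L.continuous_of_finiteDimensional.comp hA

variable {E : Type*} [NormedAddCommGroup E] [NormedSpace ℝ E]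

theorem gronwallBound_eq_add_mul (δ K ε x : ℝ) :
    gronwallBound δ K ε x = δ * Real.exp (K * x) + ε * gronwallBound 0 K 1 x := by
  by_cases hK : K = 0
  · simp [gronwallBound, hK]
  · simp only [gronwallBound, hK, if_false]; ring

theorem gronwallBound_zero_one_nonneg {K x : ℝ} (hK : 0 ≤ K) (hx : 0 ≤ x) :
    0 ≤ gronwallBound 0 K 1 x := by
  have := gronwallBound_mono le_rfl zero_le_one hK hx
  rwa [gronwallBound_x0] at this

theorem HasDerivWithinAt.Ici_of_Icc {g : ℝ → E} {g' : E} {a b t : ℝ}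
    (h : HasDerivWithinAt g g' (Icc a b) t) (ht : t ∈ Ico a b) :
    HasDerivWithinAt g g' (Ici t) t :=
  h.mono_of_mem_nhdsWithin (Icc_mem_nhdsGE_of_mem ht)

/-- Grönwall's inequality in the form used throughout: the bound is linear in the initial value and
in the defect `ε`, with constants depending only on the growth rate `K` and on the length `T`. -/
theorem norm_le_of_norm_deriv_le {g g' : ℝ → E} {δ K ε T : ℝ} (hK : 0 ≤ K) (hδ : 0 ≤ δ)
    (hε : 0 ≤ ε) (hg : ∀ t ∈ Icc 0 T, HasDerivWithinAt g (g' t) (Icc 0 T) t) (h0 : ‖g 0‖ ≤ δ)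
    (hbd : ∀ t ∈ Icc 0 T, ‖g' t‖ ≤ K * ‖g t‖ + ε) :
    ∀ t ∈ Icc 0 T, ‖g t‖ ≤ δ * Real.exp (K * T) + ε * gronwallBound 0 K 1 T := by
  intro t ht
  have h := norm_le_gronwallBound_of_norm_deriv_right_le (fun s hs => (hg s hs).continuousWithinAt)
    (fun s hs => (hg s (Ico_subset_Icc_self hs)).Ici_of_Icc hs) h0
    (fun s hs => hbd s (Ico_subset_Icc_self hs)) t ht
  rw [← gronwallBound_eq_add_mul]
  exact h.trans (gronwallBound_mono hδ hε hK (by linarith [ht.2]))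

/-- A bounded vector field that is Lipschitz in space has solutions on every compact interval,
however long: in the Picard–Lindelöf theorem the radius of the ball may be taken as large as
needed. -/
theorem exists_solution_Icc_of_bounded [CompleteSpace E] {h : ℝ → E → E} {a b : ℝ} {K : NNReal}
    {L : ℝ} (h0 : (0 : ℝ) ∈ Icc a b) (hlip : ∀ t ∈ Icc a b, LipschitzWith K (h t))
    (hcont : ∀ x, ContinuousOn (fun t => h t x) (Icc a b))
    (hbd : ∀ t ∈ Icc a b, ∀ x, ‖h t x‖ ≤ L) (x₀ : E) :
    ∃ u : ℝ → E, u 0 = x₀ ∧ ∀ t ∈ Icc a b, HasDerivWithinAt u (h t (u t)) (Icc a b) t := by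
  have hm : 0 ≤ max (b - 0) (0 - a) := le_max_of_le_left (by linarith [h0.2])
  have hpl : IsPicardLindelof h ⟨0, h0⟩ x₀ (L.toNNReal * (max (b - 0) (0 - a)).toNNReal) 0
      L.toNNReal K :=
    { lipschitzOnWith := fun t ht => (hlip t ht).lipschitzOnWith
      continuousOn := fun x _ => hcont x
      norm_le := fun t ht x _ => (hbd t ht x).trans (Real.le_coe_toNNReal L)
      mul_max_le := by
        simp only [NNReal.coe_mul, Real.coe_toNNReal _ hm]
        simp }
  exact hpl.exists_eq_forall_mem_Icc_hasDerivWithinAt₀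

/-- Two solutions of a linear equation that agree at `0` agree on every open interval on which
both are defined. -/
theorem linear_solution_unique {A : ℝ → E →L[ℝ] E} {c : ℝ → E} (hA : Continuous A)
    {u v : ℝ → E} {a b : ℝ} (h0 : (0 : ℝ) ∈ Ioo a b)
    (hu : ∀ t ∈ Ioo a b, HasDerivAt u (A t (u t) + c t) t)
    (hv : ∀ t ∈ Ioo a b, HasDerivAt v (A t (v t) + c t) t) (h : u 0 = v 0) :
    EqOn u v (Ioo a b) := by
  obtain ⟨K, hK⟩ := isCompact_Icc.exists_bound_of_continuousOn (s := Icc a b) hA.continuousOn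
  refine ODE_solution_unique_of_mem_Ioo (v := fun t x => A t x + c t) (K := K.toNNReal)
    (s := fun _ => univ) (fun t ht => ?_) h0 (fun t ht => ⟨hu t ht, trivial⟩)
    (fun t ht => ⟨hv t ht, trivial⟩) h
  refine (LipschitzWith.of_dist_le_mul fun x y => ?_).lipschitzOnWith
  rw [dist_add_right, dist_eq_norm, ← map_sub, dist_eq_norm]
  exact (A t).le_of_opNorm_le ((hK t (Ioo_subset_Icc_self ht)).trans (Real.le_coe_toNNReal K)) _

theorem linear_solution_unique_Icc {A : ℝ → E →L[ℝ] E} {c : ℝ → E} (hA : Continuous A)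
    {u v : ℝ → E} {T : ℝ}
    (hu : ∀ t ∈ Icc 0 T, HasDerivWithinAt u (A t (u t) + c t) (Icc 0 T) t)
    (hv : ∀ t ∈ Icc 0 T, HasDerivWithinAt v (A t (v t) + c t) (Icc 0 T) t) (h : u 0 = v 0) :
    EqOn u v (Icc 0 T) := by
  obtain ⟨K, hK⟩ := isCompact_Icc.exists_bound_of_continuousOn (s := Icc 0 T) hA.continuousOn
  intro t ht
  have := norm_le_of_norm_deriv_le (g := fun t => u t - v t) ((norm_nonneg _).trans (hK t ht))
    le_rfl le_rfl (fun t ht => (hu t ht).sub (hv t ht)) (by simp [h])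
    (fun t ht => by
      rw [add_sub_add_right_eq_sub, ← map_sub, add_zero]
      exact (A t).le_of_opNorm_le (hK t ht) _) t ht
  rw [zero_mul, zero_mul, add_zero, norm_le_zero_iff] at this
  exact sub_eq_zero.1 this

variable [FiniteDimensional ℝ E]

/-- A Lipschitz truncation of the identity outside of a ball. -/
theorem exists_lipschitz_truncation (ρ : ℝ) (hρ : 0 < ρ) :
    ∃ (φ : E → E) (C : NNReal) (M : ℝ), LipschitzWith C φ ∧ (∀ x, ‖φ x‖ ≤ M) ∧
      (∀ x, ‖φ x‖ ≤ ‖x‖) ∧ ∀ x, ‖x‖ ≤ ρ → φ x = x := by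
  let χ : ContDiffBump (0 : E) := ⟨ρ, ρ + 1, hρ, by linarith⟩
  have hsupp : HasCompactSupport fun x : E => χ x • x := χ.hasCompactSupport.smul_right
  have hsm : ContDiff ℝ 1 fun x : E => χ x • x := χ.contDiff.smul contDiff_id
  obtain ⟨C, hC⟩ := hsm.lipschitzWith_of_hasCompactSupport hsupp one_ne_zero
  obtain ⟨M, hM⟩ := hsupp.exists_bound_of_continuous hsm.continuous
  refine ⟨_, C, M, hC, hM, fun x => ?_, fun x hx => ?_⟩
  · rw [norm_smul, Real.norm_of_nonneg χ.nonneg]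
    exact mul_le_of_le_one_left (norm_nonneg _) χ.le_one
  · rw [χ.one_of_mem_closedBall (by simpa using hx), one_smul]

/-- Solutions of a linear equation on a symmetric interval. The right-hand side is truncated
outside of a ball that no solution leaves, by Grönwall's inequality. -/
theorem exists_linear_solution_Icc {A : ℝ → E →L[ℝ] E} {c : ℝ → E} (hA : Continuous A)
    (hc : Continuous c) (x₀ : E) {N : ℝ} (hN : 0 ≤ N) :
    ∃ u : ℝ → E, u 0 = x₀ ∧
      ∀ t ∈ Icc (-N) N, HasDerivWithinAt u (A t (u t) + c t) (Icc (-N) N) t := by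
  obtain ⟨K, hK⟩ := isCompact_Icc.exists_bound_of_continuousOn (s := Icc (-N) N) hA.continuousOn
  obtain ⟨D, hD⟩ := isCompact_Icc.exists_bound_of_continuousOn (s := Icc (-N) N) hc.continuousOn
  have hmem0 : (0 : ℝ) ∈ Icc (-N) N := ⟨by linarith, hN⟩
  have hK0 : 0 ≤ K := (norm_nonneg _).trans (hK 0 hmem0)
  have hD0 : 0 ≤ D := (norm_nonneg _).trans (hD 0 hmem0)
  set ρ := ‖x₀‖ * Real.exp (K * N) + D * gronwallBound 0 K 1 N with hρdef
  have hρ : 0 ≤ ρ := add_nonneg (by positivity)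
    (mul_nonneg hD0 (gronwallBound_zero_one_nonneg hK0 hN))
  obtain ⟨φ, C, M, hφC, hφM, hφle, hφid⟩ :=
    exists_lipschitz_truncation (E := E) (ρ + 1) (by linarith)
  have hM0 : 0 ≤ M := (norm_nonneg _).trans (hφM 0)
  have hbdA : ∀ t ∈ Icc (-N) N, ∀ x, ‖A t (φ x) + c t‖ ≤ K * ‖x‖ + D := fun t ht x =>
    (norm_add_le _ _).trans (add_le_add (((A t).le_opNorm _).trans
      (mul_le_mul (hK t ht) (hφle x) (norm_nonneg _) hK0)) (hD t ht))
  obtain ⟨u, hu0, hu⟩ := exists_solution_Icc_of_bounded (h := fun t x => A t (φ x) + c t)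
    (K := K.toNNReal * C) (L := K * M + D) hmem0
    (fun t ht => by
      refine LipschitzWith.of_dist_le_mul fun x y => ?_
      rw [dist_add_right, dist_eq_norm, ← map_sub]
      refine ((A t).le_opNorm _).trans ?_
      rw [NNReal.coe_mul, Real.coe_toNNReal _ hK0, mul_assoc]
      refine mul_le_mul (hK t ht) ?_ (norm_nonneg _) hK0
      rw [← dist_eq_norm]
      exact hφC.dist_le_mul x y)
    (fun x => by fun_prop)
    (fun t ht x => (norm_add_le _ _).trans (add_le_add (((A t).le_opNorm _).trans
      (mul_le_mul (hK t ht) (hφM x) (norm_nonneg _) hK0)) (hD t ht))) x₀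
  refine ⟨u, hu0, fun t ht => ?_⟩
  have hub : ∀ t ∈ Icc (-N) N, ‖u t‖ ≤ ρ := by
    have hpos := norm_le_of_norm_deriv_le (T := N) hK0 (norm_nonneg x₀) hD0
      (fun t ht => (hu t ⟨by linarith [ht.1], ht.2⟩).mono (Icc_subset_Icc_left (by linarith)))
      (by rw [hu0]) (fun t ht => hbdA t ⟨by linarith [ht.1], ht.2⟩ (u t))
    have hneg := norm_le_of_norm_deriv_le (g := fun t => u (-t)) (T := N) hK0 (norm_nonneg x₀) hD0
      (fun t ht => (hu (-t) ⟨by linarith [ht.2], by linarith [ht.1]⟩).scomp t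
        (hasDerivAt_neg t).hasDerivWithinAt
        (fun s hs => ⟨by linarith [hs.2], by linarith [hs.1]⟩))
      (by simp [hu0]) (fun t ht => by
        rw [neg_one_smul, norm_neg]
        exact hbdA (-t) ⟨by linarith [ht.2], by linarith [ht.1]⟩ (u (-t)))
    intro t ht
    rcases le_total 0 t with h | h
    · exact hpos t ⟨h, ht.2⟩
    · simpa using hneg (-t) ⟨by linarith, by linarith [ht.1]⟩
  have := hu t ht
  rwa [hφid (u t) (by linarith [hub t ht])] at this

/-- A linear equation with continuous coefficients has global solutions. -/
theorem exists_linear_solution {A : ℝ → E →L[ℝ] E} {c : ℝ → E} (hA : Continuous A)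
    (hc : Continuous c) (x₀ : E) :
    ∃ u : ℝ → E, u 0 = x₀ ∧ ∀ t, HasDerivAt u (A t (u t) + c t) t := by
  choose u hu0 hu using fun N : ℕ => exists_linear_solution_Icc hA hc x₀ (N := N) N.cast_nonneg
  have hd : ∀ (N : ℕ), ∀ t ∈ Ioo (-(N : ℝ)) N, HasDerivAt (u N) (A t (u N t) + c t) t :=
    fun N t ht => (hu N t (Ioo_subset_Icc_self ht)).hasDerivAt (Icc_mem_nhds ht.1 ht.2)
  have heq : ∀ N M : ℕ, N ≤ M → ∀ t : ℝ, |t| < N → u M t = u N t := by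
    intro N M hNM t ht
    have hN : (0 : ℝ) < N := (abs_nonneg t).trans_lt ht
    have hle : (N : ℝ) ≤ M := by exact_mod_cast hNM
    exact linear_solution_unique (c := c) hA (a := -N) (b := N) ⟨by linarith, hN⟩
      (fun s hs => hd M s ⟨by linarith [hs.1], by linarith [hs.2]⟩) (hd N)
      (by rw [hu0, hu0]) (abs_lt.1 ht)
  refine ⟨fun t => u (⌈|t|⌉₊ + 1) t, hu0 _, fun t => ?_⟩
  set N := ⌈|t|⌉₊ + 2 with hN
  have htN : |t| + 1 < N := by
    have := Nat.le_ceil |t|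
    push_cast [hN]; linarith
  have hloc : (fun s => u (⌈|s|⌉₊ + 1) s) =ᶠ[𝓝 t] u N := by
    filter_upwards [continuous_abs.continuousAt.eventually_lt_const
      (show |t| < |t| + 1 by linarith)] with s hs
    refine (heq _ _ ?_ s ?_).symm
    · have : ⌈|s|⌉₊ ≤ ⌈|t|⌉₊ + 1 := by
        rw [Nat.ceil_le]; push_cast; linarith [Nat.le_ceil |t|]
      omega
    · push_cast; linarith [Nat.le_ceil |s|]
  have := (hd N t (abs_lt.1 (by linarith))).congr_of_eventuallyEq hloc
  rwa [← hloc.eq_of_nhds] at this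

end ODE

/-! ### Differentiable dependence of solutions on their initial values -/

section Flow

variable {E : Type*} [NormedAddCommGroup E] [NormedSpace ℝ E]

/-- A compactly supported `C¹` map is strictly differentiable, uniformly over all points. -/
theorem exists_uniform_strict_derivative {G : E → E} (hG : ContDiff ℝ 1 G)
    (hGs : HasCompactSupport G) {ε : ℝ} (hε : 0 < ε) :
    ∃ δ > 0, ∀ z x y, dist x z < δ → dist y z < δ →
      ‖G x - G y - fderiv ℝ G z (x - y)‖ ≤ ε * ‖x - y‖ := by
  have huc : UniformContinuous (fderiv ℝ G) :=
    (hGs.fderiv ℝ).uniformContinuous_of_continuous (hG.continuous_fderiv one_ne_zero)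
  obtain ⟨δ, hδ, h⟩ := Metric.uniformContinuous_iff.1 huc ε hε
  refine ⟨δ, hδ, fun z x y hx hy => ?_⟩
  refine (convex_ball z δ).norm_image_sub_le_of_norm_fderiv_le' (𝕜 := ℝ)
    (fun w _ => hG.differentiable one_ne_zero w) (fun w hw => ?_) hy hx
  rw [← dist_eq_norm]
  exact (h hw).le

/-- The flow of a compactly supported `C¹` field is strictly differentiable in the initial value,
uniformly over `[0, T]`, and its derivative is the solution of the variational equation. -/
theorem flow_strict_derivative {G : E → E} (hG : ContDiff ℝ 1 G) (hGs : HasCompactSupport G)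
    {K : NNReal} (hK : LipschitzWith K G) {T : ℝ} (hT : 0 ≤ T) {u : E → ℝ → E}
    (hu0 : ∀ y, u y 0 = y)
    (hu : ∀ y, ∀ t ∈ Icc 0 T, HasDerivWithinAt (u y) (G (u y t)) (Icc 0 T) t)
    {y₀ : E} {W : ℝ → E →L[ℝ] E} (hW0 : W 0 = ContinuousLinearMap.id ℝ E)
    (hW : ∀ t ∈ Icc 0 T, HasDerivWithinAt W (fderiv ℝ G (u y₀ t) ∘L W t) (Icc 0 T) t)
    {ε : ℝ} (hε : 0 < ε) :
    ∃ δ > 0, ∀ p q, dist p y₀ < δ → dist q y₀ < δ → ∀ t ∈ Icc 0 T,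
      ‖u p t - u q t - W t (p - q)‖ ≤ ε * ‖p - q‖ := by
  have hlip : ∀ p q, ∀ t ∈ Icc 0 T, ‖u p t - u q t‖ ≤ Real.exp (K * T) * ‖p - q‖ := by
    intro p q t ht
    have := norm_le_of_norm_deriv_le (g := fun t => u p t - u q t) (K := K) K.coe_nonneg
      (norm_nonneg (p - q)) le_rfl (fun t ht => (hu p t ht).sub (hu q t ht))
      (by simp [hu0]) (fun t ht => by simpa using hK.norm_sub_le (u p t) (u q t)) t ht
    linarith
  set C := Real.exp (K * T) * gronwallBound 0 K 1 T with hC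
  have hC0 : 0 ≤ C := mul_nonneg (Real.exp_pos _).le
    (gronwallBound_zero_one_nonneg K.coe_nonneg hT)
  set η := ε / (C + 1) with hη
  have hη0 : 0 < η := div_pos hε (by linarith)
  obtain ⟨δ, hδ, hstrict⟩ := exists_uniform_strict_derivative hG hGs hη0
  have hexp := Real.exp_pos (K * T)
  refine ⟨δ / Real.exp (K * T), div_pos hδ hexp, fun p q hp hq t ht => ?_⟩
  have hclose : ∀ p, dist p y₀ < δ / Real.exp (K * T) → ∀ t ∈ Icc 0 T,
      dist (u p t) (u y₀ t) < δ := by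
    intro p hp t ht
    rw [dist_eq_norm] at hp ⊢
    refine (hlip p y₀ t ht).trans_lt ?_
    rwa [lt_div_iff₀' hexp] at hp
  have hRd : ∀ t ∈ Icc 0 T, HasDerivWithinAt (fun t => u p t - u q t - W t (p - q))
      (G (u p t) - G (u q t) - fderiv ℝ G (u y₀ t) (W t (p - q))) (Icc 0 T) t := by
    intro t ht
    have hWpq : HasDerivWithinAt (fun t => W t (p - q))
        ((fderiv ℝ G (u y₀ t) ∘L W t) (p - q)) (Icc 0 T) t := by
      simpa using (hW t ht).clm_apply (hasDerivWithinAt_const t _ (p - q))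
    exact ((hu p t ht).sub (hu q t ht)).sub hWpq
  have hbd : ∀ t ∈ Icc 0 T, ‖G (u p t) - G (u q t) - fderiv ℝ G (u y₀ t) (W t (p - q))‖ ≤
      K * ‖u p t - u q t - W t (p - q)‖ + η * (Real.exp (K * T) * ‖p - q‖) := by
    intro t ht
    have e : G (u p t) - G (u q t) - fderiv ℝ G (u y₀ t) (W t (p - q)) =
        fderiv ℝ G (u y₀ t) (u p t - u q t - W t (p - q)) +
          (G (u p t) - G (u q t) - fderiv ℝ G (u y₀ t) (u p t - u q t)) := by
      rw [map_sub (fderiv ℝ G (u y₀ t)) (u p t - u q t)]; abel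
    rw [e]
    refine (norm_add_le _ _).trans (add_le_add ?_ ?_)
    · exact (fderiv ℝ G (u y₀ t)).le_of_opNorm_le (norm_fderiv_le_of_lipschitz ℝ hK) _
    · exact (hstrict _ _ _ (hclose p hp t ht) (hclose q hq t ht)).trans
        (mul_le_mul_of_nonneg_left (hlip p q t ht) hη0.le)
  have h := norm_le_of_norm_deriv_le K.coe_nonneg le_rfl (by positivity) hRd
    (by simp [hu0, hW0]) hbd t ht
  refine h.trans ?_
  have : η * C ≤ ε := by
    rw [hη, div_mul_eq_mul_div, div_le_iff₀ (by linarith)]; nlinarith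
  calc _ = η * C * ‖p - q‖ := by rw [hC]; ring
    _ ≤ _ := mul_le_mul_of_nonneg_right this (norm_nonneg _)

/-- Uniqueness against a competitor that is not known to stay where the field is regular: a
solution in an open set `V` on which the field agrees with a Lipschitz field coincides with every
solution that starts at the same point. -/
theorem solution_unique_of_mem_open {G G' : E → E} {V : Set E} (hV : IsOpen V)
    {K : NNReal} (hK : LipschitzWith K G') (hGG' : EqOn G' G V) {T : ℝ}
    {u v : ℝ → E} (hu : ∀ t ∈ Icc 0 T, HasDerivWithinAt u (G (u t)) (Icc 0 T) t)
    (huV : ∀ t ∈ Icc 0 T, u t ∈ V)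
    (hv : ∀ t ∈ Icc 0 T, HasDerivWithinAt v (G (v t)) (Icc 0 T) t) (h0 : v 0 = u 0) :
    EqOn v u (Icc 0 T) := by
  have huc : ContinuousOn u (Icc 0 T) := fun t ht => (hu t ht).continuousWithinAt
  have hvc : ContinuousOn v (Icc 0 T) := fun t ht => (hv t ht).continuousWithinAt
  rcases lt_or_ge T 0 with hT | hT
  · simp [Icc_eq_empty_of_lt hT]
  have hclosed : IsClosed ({t | v t = u t} ∩ Icc 0 T) := by
    have := (hvc.sub huc).preimage_isClosed_of_isClosed isClosed_Icc (isClosed_singleton (x := 0))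
    convert this using 1
    ext t
    simp [sub_eq_zero, and_comm]
  refine fun t ht => IsClosed.Icc_subset_of_forall_exists_gt hclosed h0 ?_ ht
  rintro s ⟨hs, hsT⟩ r hr
  have hsI : s ∈ Icc 0 T := Ico_subset_Icc_self hsT
  have hmem : ∀ᶠ τ in 𝓝[Icc 0 T] s, v τ ∈ V :=
    (hvc s hsI).eventually (hV.mem_nhds (by rw [Set.mem_ofPred.1 hs]; exact huV s hsI))
  obtain ⟨δ, hδ, hball⟩ := Metric.mem_nhdsWithin_iff.1 hmem
  set e := min (min r T) (s + δ / 2) with he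
  have hse : s < e := lt_min (lt_min hr hsT.2) (by linarith)
  have heT : e ≤ T := (min_le_left _ _).trans (min_le_right _ _)
  have her : e ≤ r := (min_le_left _ _).trans (min_le_left _ _)
  have heδ : e ≤ s + δ / 2 := min_le_right _ _
  have hsub : Icc s e ⊆ Icc 0 T := Icc_subset_Icc hsT.1 heT
  have hvV : ∀ τ ∈ Icc s e, v τ ∈ V := fun τ hτ => hball
    ⟨by rw [Metric.mem_ball, Real.dist_eq, abs_lt]; constructor <;> linarith [hτ.1, hτ.2],
      hsub hτ⟩
  have := ODE_solution_unique (v := fun _ => G') (K := K) (a := s) (b := e) (f := v) (g := u)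
    (fun _ => hK) (hvc.mono hsub)
    (fun τ hτ => by
      rw [hGG' (hvV τ (Ico_subset_Icc_self hτ))]
      exact ((hv τ (hsub (Ico_subset_Icc_self hτ))).mono hsub).Ici_of_Icc hτ)
    (huc.mono hsub)
    (fun τ hτ => by
      rw [hGG' (huV τ (hsub (Ico_subset_Icc_self hτ)))]
      exact ((hu τ (hsub (Ico_subset_Icc_self hτ))).mono hsub).Ici_of_Icc hτ) hs
  exact ⟨e, this (right_mem_Icc.2 hse.le), hse, her⟩

variable [FiniteDimensional ℝ E]

/-- A `C¹` vector field on an open set agrees, near a compact subset, with a compactly supported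
`C¹` field on the whole space. -/
theorem exists_compactly_supported_extension {G : E → E} {Ω : Set E} (hΩ : IsOpen Ω)
    (hG : ContDiffOn ℝ 1 G Ω) {S : Set E} (hS : IsCompact S) (hSΩ : S ⊆ Ω) :
    ∃ (G' : E → E) (V : Set E), ContDiff ℝ 1 G' ∧ HasCompactSupport G' ∧ IsOpen V ∧ S ⊆ V ∧
      V ⊆ Ω ∧ EqOn G' G V := by
  obtain ⟨L, hL, hSL, hLΩ⟩ := exists_compact_between hS hΩ hSΩ
  obtain ⟨χ, hχ1, hχ0, -⟩ := exists_contMDiffMap_one_nhds_of_subset_interior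
    (n := 1) (modelWithCornersSelf ℝ E) hS.isClosed hSL
  have hχ : ContDiff ℝ 1 χ := χ.contMDiff.contDiff
  obtain ⟨V, hV, hSV, hV1⟩ := eventually_nhdsSet_iff_exists.1 hχ1
  have hsupp : ∀ x ∉ L, χ x • G x = 0 := fun x hx => by rw [hχ0 x hx, zero_smul]
  refine ⟨fun x => χ x • G x, V ∩ interior L, ?_, HasCompactSupport.intro hL hsupp,
    hV.inter isOpen_interior, subset_inter hSV hSL, fun x hx => hLΩ (interior_subset hx.2),
    fun x hx => by simp [hV1 x hx.1]⟩
  rw [contDiff_iff_contDiffAt]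
  intro x
  by_cases hx : x ∈ Ω
  · exact hχ.contDiffAt.smul (hG.contDiffAt (hΩ.mem_nhds hx))
  · have : (fun x => χ x • G x) =ᶠ[𝓝 x] fun _ => 0 := by
      filter_upwards [hL.isClosed.isOpen_compl.mem_nhds fun h => hx (hLΩ h)] with y hy
      exact hsupp y hy
    exact contDiffAt_const.congr_of_eventuallyEq this

/-- Differentiable dependence on initial values along a given solution `c` on `[0, T]` of an
equation whose field is `C¹` near `c`: solutions exist and are unique for nearby initial values, and
they are strictly differentiable in the initial value, uniformly over `[0, T]`. -/
theorem exists_flow {G : E → E} {Ω : Set E} (hΩ : IsOpen Ω) (hG : ContDiffOn ℝ 1 G Ω)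
    {T : ℝ} (hT : 0 ≤ T) {c : ℝ → E}
    (hc : ∀ t ∈ Icc 0 T, HasDerivWithinAt c (G (c t)) (Icc 0 T) t)
    (hcΩ : ∀ t ∈ Icc 0 T, c t ∈ Ω) :
    ∃ (u : E → ℝ → E) (W : ℝ → E →L[ℝ] E),
      (∀ᶠ y in 𝓝 (c 0), u y 0 = y ∧
        (∀ t ∈ Icc 0 T, HasDerivWithinAt (u y) (G (u y t)) (Icc 0 T) t) ∧
        ∀ v : ℝ → E, v 0 = y → (∀ t ∈ Icc 0 T, HasDerivWithinAt v (G (v t)) (Icc 0 T) t) →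
          EqOn v (u y) (Icc 0 T)) ∧
      W 0 = ContinuousLinearMap.id ℝ E ∧
      (∀ t ∈ Icc 0 T, HasDerivWithinAt W (fderiv ℝ G (c t) ∘L W t) (Icc 0 T) t) ∧
      ∀ ε > 0, ∃ δ > 0, ∀ p q, dist p (c 0) < δ → dist q (c 0) < δ → ∀ t ∈ Icc 0 T,
        ‖u p t - u q t - W t (p - q)‖ ≤ ε * ‖p - q‖ := by
  have hcc : ContinuousOn c (Icc 0 T) := fun t ht => (hc t ht).continuousWithinAt
  have hS : IsCompact (c '' Icc 0 T) := isCompact_Icc.image_of_continuousOn hcc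
  obtain ⟨G', V, hG', hG's, hV, hSV, hVΩ, hEq⟩ := exists_compactly_supported_extension hΩ hG hS
    (image_subset_iff.2 hcΩ)
  obtain ⟨K, hK⟩ := hG'.lipschitzWith_of_hasCompactSupport hG's one_ne_zero
  obtain ⟨L, hL⟩ := hG's.exists_bound_of_continuous hG'.continuous
  choose u hu0 hu using exists_solution_Icc_of_bounded (h := fun _ => G') (K := K)
    (left_mem_Icc.2 hT) (fun _ _ => hK) (fun _ => continuousOn_const) (fun _ _ => hL)
  have hcV : ∀ t ∈ Icc 0 T, c t ∈ V := fun t ht => hSV (mem_image_of_mem c ht)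
  have hcu : EqOn c (u (c 0)) (Icc 0 T) := by
    refine ODE_solution_unique (v := fun _ => G') (K := K) (fun _ => hK) hcc ?_
      (fun t ht => (hu _ t ht).continuousWithinAt) ?_ (hu0 _).symm
    · intro t ht
      rw [hEq (hcV t (Ico_subset_Icc_self ht))]
      exact (hc t (Ico_subset_Icc_self ht)).Ici_of_Icc ht
    · exact fun t ht => (hu _ t (Ico_subset_Icc_self ht)).Ici_of_Icc ht
  -- the variational equation, with coefficients extended continuously outside of `[0, T]`
  have hAc : Continuous fun t : ℝ =>
      ContinuousLinearMap.compL ℝ E E E (fderiv ℝ G' (c (projIcc 0 T hT t))) := by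
    refine (ContinuousLinearMap.compL ℝ E E E).continuous.comp
      ((hG'.continuous_fderiv one_ne_zero).comp ?_)
    exact hcc.domRestrict.comp continuous_projIcc
  obtain ⟨W, hW0, hW⟩ := exists_linear_solution hAc (continuous_const (y := 0))
    (ContinuousLinearMap.id ℝ E)
  have hW' : ∀ t ∈ Icc 0 T,
      HasDerivWithinAt W (fderiv ℝ G' (c t) ∘L W t) (Icc 0 T) t := by
    intro t ht
    have := (hW t).hasDerivWithinAt (s := Icc 0 T)
    rw [projIcc_of_mem hT ht] at this
    simpa using this
  refine ⟨u, W, ?_, hW0, fun t ht => ?_, fun ε hε => ?_⟩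
  · obtain ⟨δ, hδ, hthick⟩ := hS.exists_thickening_subset_open hV hSV
    have hexp := Real.exp_pos (K * T)
    filter_upwards [Metric.ball_mem_nhds (c 0) (div_pos hδ hexp)] with y hy
    have huV : ∀ t ∈ Icc 0 T, u y t ∈ V := by
      intro t ht
      refine hthick (Metric.mem_thickening_iff.2 ⟨c t, mem_image_of_mem c ht, ?_⟩)
      rw [hcu ht]
      have := dist_le_of_trajectories_ODE (v := fun _ => G') (K := K) (fun _ => hK)
        (fun t ht => (hu y t ht).continuousWithinAt)
        (fun t ht => (hu y t (Ico_subset_Icc_self ht)).Ici_of_Icc ht)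
        (fun t ht => (hu (c 0) t ht).continuousWithinAt)
        (fun t ht => (hu (c 0) t (Ico_subset_Icc_self ht)).Ici_of_Icc ht)
        (δ := dist y (c 0)) (by rw [hu0, hu0]) t ht
      refine this.trans_lt ?_
      rw [Metric.mem_ball, lt_div_iff₀ hexp] at hy
      refine lt_of_le_of_lt ?_ hy
      gcongr
      linarith [ht.2]
    have huG : ∀ t ∈ Icc 0 T, HasDerivWithinAt (u y) (G (u y t)) (Icc 0 T) t := fun t ht => by
      rw [← hEq (huV t ht)]; exact hu y t ht
    exact ⟨hu0 y, huG, fun v hv0 hv =>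
      solution_unique_of_mem_open hV hK hEq huG huV hv (by rw [hv0, hu0])⟩
  · have : fderiv ℝ G (c t) = fderiv ℝ G' (c t) :=
      ((hEq.eventuallyEq_of_mem (hV.mem_nhds (hcV t ht))).fderiv_eq).symm
    rw [this]
    exact hW' t ht
  · refine flow_strict_derivative hG' hG's hK hT hu0 hu hW0 (fun t ht => ?_) hε
    rw [← hcu ht]
    exact hW' t ht

end Flow

/-! ### The profile as a function of its parameters -/

namespace PeriodicWave

variable {n : ℕ}

theorem _root_.HasDerivWithinAt.clm_map {E F : Type*} [NormedAddCommGroup E] [NormedSpace ℝ E]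
    [NormedAddCommGroup F] [NormedSpace ℝ F] {g : ℝ → E} {g' : E} {s : Set ℝ} {t : ℝ}
    (h : HasDerivWithinAt g g' s t) (L : E →L[ℝ] F) :
    HasDerivWithinAt (fun t => L (g t)) (L g') s t :=
  L.hasFDerivAt.comp_hasDerivWithinAt t h

theorem contDiff_det {E : Type*} [NormedAddCommGroup E] [NormedSpace ℝ E] {m : ℕ∞}
    {M : E → Matrix (Fin n) (Fin n) ℝ} (hM : ∀ i j, ContDiff ℝ m fun x => M x i j) :
    ContDiff ℝ m fun x => (M x).det := by
  simp only [Matrix.det_apply]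
  exact ContDiff.sum fun σ _ => (contDiff_prod fun i _ => hM _ _).const_smul _

theorem contDiffOn_inv_entry {E : Type*} [NormedAddCommGroup E] [NormedSpace ℝ E] {m : ℕ∞}
    {M : E → Matrix (Fin n) (Fin n) ℝ} (hM : ∀ i j, ContDiff ℝ m fun x => M x i j) (i j : Fin n) :
    ContDiffOn ℝ m (fun x => (M x)⁻¹ i j) {x | (M x).det ≠ 0} := by
  have hadj : ContDiff ℝ m fun x => (M x).adjugate i j := by
    simp only [Matrix.adjugate_apply]
    refine contDiff_det fun k l => ?_
    by_cases hk : k = j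
    · simpa [Matrix.updateRow_apply, hk] using contDiff_const
    · simpa [Matrix.updateRow_apply, hk] using hM k l
  have hinv : ContDiffOn ℝ m (fun x => ((M x).det)⁻¹) {x | (M x).det ≠ 0} :=
    (contDiff_det hM).contDiffOn.inv fun x hx => hx
  refine (hinv.mul hadj.contDiffOn).congr fun x _ => ?_
  simp [Matrix.inv_def, Ring.inverse_eq_inv']

theorem clm_apply_eq_sum {F : Type*} [NormedAddCommGroup F] [NormedSpace ℝ F]
    (L : State n →L[ℝ] F) (w : State n) : L w = ∑ j, w j • L (Pi.single j 1) := by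
  have : w = ∑ j, w j • (Pi.single j 1 : State n) := by
    ext i
    simp [Finset.sum_apply, Pi.single_apply]
  conv_lhs => rw [this]
  simp only [map_sum, map_smul]

/-- The multiplication by the Jacobian matrix is the derivative. -/
theorem jacobian_mulVec (g : State n → State n) (u w : State n) :
    jacobian g u *ᵥ w = fderiv ℝ g u w := by
  ext i
  rw [clm_apply_eq_sum, Finset.sum_apply]
  simp [Matrix.mulVec, dotProduct, jacobian, mul_comm]

theorem coeffA_mulVec (f : State n → State n) (B : State n → Matrix (Fin n) (Fin n) ℝ)
    (ub : ℝ → State n) (x : ℝ) (w : State n) (i : Fin n) :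
    (coeffA f B ub x *ᵥ w) i = fderiv ℝ f (ub x) w i -
      ∑ k, fderiv ℝ (fun v => B v i k) (ub x) w * deriv ub x k := by
  have hB : ∀ k, fderiv ℝ (fun v => B v i k) (ub x) w =
      ∑ j, fderiv ℝ (fun v => B v i k) (ub x) (Pi.single j 1) * w j := fun k => by
    rw [clm_apply_eq_sum]
    exact Finset.sum_congr rfl fun j _ => mul_comm _ _
  rw [← jacobian_mulVec]
  simp only [hB, Matrix.mulVec, dotProduct, coeffA, Matrix.of_apply, sub_mul,
    Finset.sum_sub_distrib, Finset.sum_mul]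
  congr 1
  rw [Finset.sum_comm]
  exact Finset.sum_congr rfl fun k _ => Finset.sum_congr rfl fun j _ => by ring

/-- A periodic wave along which the viscosity matrix is invertible. -/
structure IsRegularWave (f : State n → State n) (B : State n → Matrix (Fin n) (Fin n) ℝ)
    (ub : ℝ → State n) (um : State n) (T : ℝ) : Prop where
  pos : 0 < T
  periodic : Function.Periodic ub T
  hasDerivAt : ∀ x, HasDerivAt ub (field f B um 0 (ub x)) x
  contDiff_flux : ContDiff ℝ 2 f
  contDiff_visc : ∀ i j, ContDiff ℝ 2 fun u => B u i j
  det_ne_zero : ∀ x, (B (ub x)).det ≠ 0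

/-- The parameters `(u₋, u₀, s)` of the traveling-wave equation. -/
abbrev Param (n : ℕ) : Type := State n × State n × ℝ

/-- The traveling-wave equation with its parameters `u₋` and `s` adjoined to the state, so that
dependence on parameters becomes dependence on the initial value `(u₋, u₀, s)`. -/
noncomputable def extendedField (f : State n → State n) (B : State n → Matrix (Fin n) (Fin n) ℝ)
    (y : Param n) : Param n :=
  (0, field f B y.1 y.2.2 y.2.1, 0)

variable {f : State n → State n} {B : State n → Matrix (Fin n) (Fin n) ℝ}

theorem isOpen_regular (hB : ∀ i j, ContDiff ℝ 2 fun u => B u i j) :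
    IsOpen {y : Param n | (B y.2.1).det ≠ 0} :=
  isOpen_ne_fun ((contDiff_det (m := 2) hB).continuous.comp (by fun_prop)) continuous_const

theorem contDiffOn_field (hf : ContDiff ℝ 2 f) (hB : ∀ i j, ContDiff ℝ 2 fun u => B u i j) :
    ContDiffOn ℝ 2 (fun y : Param n => field f B y.1 y.2.2 y.2.1)
      {y : Param n | (B y.2.1).det ≠ 0} := by
  rw [contDiffOn_pi]
  intro i
  simp only [field, Matrix.mulVec, dotProduct]
  refine ContDiffOn.sum fun k _ => ContDiffOn.mul ?_ (ContDiff.contDiffOn ?_)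
  · exact contDiffOn_inv_entry (m := 2) (M := fun y : Param n => B y.2.1)
      (fun i j => (hB i j).comp (by fun_prop)) i k
  · exact contDiff_pi.1 (by fun_prop) k

theorem contDiffOn_extendedField (hf : ContDiff ℝ 2 f)
    (hB : ∀ i j, ContDiff ℝ 2 fun u => B u i j) :
    ContDiffOn ℝ 2 (extendedField f B) {y : Param n | (B y.2.1).det ≠ 0} :=
  contDiffOn_const.prodMk ((contDiffOn_field hf hB).prodMk contDiffOn_const)

/-- The linearized traveling-wave equation, obtained by differentiating
`B(u) u' = f(u) - f(u₋) - s (u - u₋)`. -/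
theorem mulVec_fderiv_field (hf : ContDiff ℝ 2 f) (hB : ∀ i j, ContDiff ℝ 2 fun u => B u i j)
    {y : Param n} (hy : (B y.2.1).det ≠ 0) (h : Param n) (i : Fin n) :
    (B y.2.1 *ᵥ fderiv ℝ (fun y : Param n => field f B y.1 y.2.2 y.2.1) y h) i =
      fderiv ℝ f y.2.1 h.2.1 i -
        ∑ k, fderiv ℝ (fun v => B v i k) y.2.1 h.2.1 * field f B y.1 y.2.2 y.2.1 k -
        fderiv ℝ f y.1 h.1 i - h.2.2 * (y.2.1 - y.1) i - y.2.2 * (h.2.1 - h.1) i := by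
  set F := fun y : Param n => field f B y.1 y.2.2 y.2.1 with hF
  have hreg := (isOpen_regular hB).mem_nhds hy
  have hFd : HasFDerivAt F (fderiv ℝ F y) y :=
    (((contDiffOn_field hf hB).contDiffAt hreg).differentiableAt two_ne_zero).hasFDerivAt
  have hfd : ∀ u, HasFDerivAt f (fderiv ℝ f u) u := fun u =>
    (hf.differentiable two_ne_zero u).hasFDerivAt
  have hu : HasFDerivAt (fun y : Param n => y.2.1)
      (ContinuousLinearMap.fst ℝ _ _ ∘L ContinuousLinearMap.snd ℝ (State n) (State n × ℝ)) y :=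
    hasFDerivAt_fst.comp y hasFDerivAt_snd
  have hs : HasFDerivAt (fun y : Param n => y.2.2)
      (ContinuousLinearMap.snd ℝ _ _ ∘L ContinuousLinearMap.snd ℝ (State n) (State n × ℝ)) y :=
    hasFDerivAt_snd.comp y hasFDerivAt_snd
  have hv : HasFDerivAt (fun y : Param n => y.1)
      (ContinuousLinearMap.fst ℝ (State n) (State n × ℝ)) y := hasFDerivAt_fst
  have hL : HasFDerivAt (fun y : Param n => (B y.2.1 *ᵥ F y) i) _ y :=
    HasFDerivAt.fun_sum fun k (_ : k ∈ Finset.univ) =>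
      ((((hB i k).differentiable two_ne_zero _).hasFDerivAt.comp y hu).mul
        ((hasFDerivAt_pi'.1 hFd) k))
  have hR : HasFDerivAt (fun y : Param n => (f y.2.1 - f y.1 - y.2.2 • (y.2.1 - y.1)) i) _ y :=
    (hasFDerivAt_pi'.1 ((((hfd _).comp y hu).sub ((hfd _).comp y hv)).sub
      (hs.smul (hu.sub hv)))) i
  have heq : (fun y : Param n => (B y.2.1 *ᵥ F y) i) =ᶠ[𝓝 y]
      fun y : Param n => (f y.2.1 - f y.1 - y.2.2 • (y.2.1 - y.1)) i := by
    filter_upwards [hreg] with z hz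
    have hz' : IsUnit (B z.2.1).det := isUnit_iff_ne_zero.2 hz
    simp only [hF, field, Matrix.mulVec_mulVec, Matrix.mul_nonsing_inv _ hz', Matrix.one_mulVec]
  have key := congrArg (fun L => L h) ((hL.congr_of_eventuallyEq heq.symm).unique hR)
  simp only [_root_.sum_apply, _root_.add_apply,
    _root_.smul_apply, ContinuousLinearMap.comp_apply, _root_.sub_apply,
    ContinuousLinearMap.proj_apply, ContinuousLinearMap.smulRight_apply,
    ContinuousLinearMap.coe_fst', ContinuousLinearMap.coe_snd', Pi.sub_apply, Pi.add_apply,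
    Pi.smul_apply, smul_eq_mul, Finset.sum_add_distrib, Function.comp_apply] at key
  simp only [Matrix.mulVec, dotProduct, Pi.sub_apply]
  have hc : ∑ k, fderiv ℝ (fun v => B v i k) y.2.1 h.2.1 * F y k =
      ∑ k, F y k * fderiv ℝ (fun v => B v i k) y.2.1 h.2.1 :=
    Finset.sum_congr rfl fun k _ => mul_comm _ _
  linarith

namespace IsRegularWave

variable {ub : ℝ → State n} {um : State n} {T : ℝ} (hw : IsRegularWave f B ub um T)
include hw

theorem deriv_eq (x : ℝ) : deriv ub x = field f B um 0 (ub x) := (hw.hasDerivAt x).deriv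

theorem continuous : Continuous ub :=
  continuous_iff_continuousAt.2 fun x => (hw.hasDerivAt x).continuousAt

theorem isUnit_det (x : ℝ) : IsUnit (B (ub x)).det := isUnit_iff_ne_zero.2 (hw.det_ne_zero x)

/-- The linearized traveling-wave equation along the wave. -/
theorem fderiv_field (x : ℝ) (h : Param n) :
    fderiv ℝ (fun y : Param n => field f B y.1 y.2.2 y.2.1) (um, ub x, 0) h =
      (B (ub x))⁻¹ *ᵥ (coeffA f B ub x *ᵥ h.2.1 - jacobian f um *ᵥ h.1 -
        h.2.2 • (ub x - um)) := by
  have key : B (ub x) *ᵥ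
      fderiv ℝ (fun y : Param n => field f B y.1 y.2.2 y.2.1) (um, ub x, 0) h =
        coeffA f B ub x *ᵥ h.2.1 - jacobian f um *ᵥ h.1 - h.2.2 • (ub x - um) := by
    ext i
    rw [mulVec_fderiv_field hw.contDiff_flux hw.contDiff_visc (y := (um, ub x, 0))
      (hw.det_ne_zero x)]
    simp only [Pi.sub_apply, coeffA_mulVec, jacobian_mulVec, Pi.smul_apply, smul_eq_mul,
      hw.deriv_eq]
    ring
  rw [← key, Matrix.mulVec_mulVec, Matrix.nonsing_inv_mul _ (hw.isUnit_det x), Matrix.one_mulVec]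

theorem differentiableAt_field (x : ℝ) :
    DifferentiableAt ℝ (fun y : Param n => field f B y.1 y.2.2 y.2.1) (um, ub x, 0) :=
  ((contDiffOn_field hw.contDiff_flux hw.contDiff_visc).contDiffAt
    ((isOpen_regular hw.contDiff_visc).mem_nhds (hw.det_ne_zero x))).differentiableAt two_ne_zero

/-- The derivative of the wave solves the linearized traveling-wave equation. -/
theorem hasDerivAt_deriv (x : ℝ) :
    HasDerivAt (deriv ub) ((B (ub x))⁻¹ *ᵥ (coeffA f B ub x *ᵥ deriv ub x)) x := by
  have hcurve : HasDerivAt (fun x => ((um, ub x, 0) : Param n)) (0, deriv ub x, 0) x := by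
    rw [hw.deriv_eq]
    exact (hasDerivAt_const x um).prodMk ((hw.hasDerivAt x).prodMk (hasDerivAt_const x 0))
  have := (hw.differentiableAt_field x).hasFDerivAt.comp_hasDerivAt x hcurve
  rw [hw.fderiv_field] at this
  have e : deriv ub = (fun y : Param n => field f B y.1 y.2.2 y.2.1) ∘
      fun x => ((um, ub x, 0) : Param n) := funext hw.deriv_eq
  rw [e]
  rw [← e] at this ⊢
  simpa using this

theorem contDiff_wave : ContDiff ℝ 1 ub :=
  contDiff_one_iff_deriv.2 ⟨fun x => (hw.hasDerivAt x).differentiableAt,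
    continuous_iff_continuousAt.2 fun x => (hw.hasDerivAt_deriv x).continuousAt⟩

theorem contDiff_deriv : ContDiff ℝ 1 (deriv ub) := by
  have e : deriv ub = (fun y : Param n => field f B y.1 y.2.2 y.2.1) ∘
      fun x => ((um, ub x, 0) : Param n) := funext hw.deriv_eq
  rw [e]
  exact ((contDiffOn_field hw.contDiff_flux hw.contDiff_visc).of_le one_le_two).comp_contDiff
    (contDiff_const.prodMk (hw.contDiff_wave.prodMk contDiff_const)) hw.det_ne_zero

theorem contDiff_visc_wave (i j : Fin n) : ContDiff ℝ 1 fun x => B (ub x) i j :=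
  ((hw.contDiff_visc i j).of_le one_le_two).comp hw.contDiff_wave

theorem contDiff_coeffA (i j : Fin n) : ContDiff ℝ 1 fun x => coeffA f B ub x i j := by
  have hf' : ContDiff ℝ 1 (fderiv ℝ f) := hw.contDiff_flux.fderiv_right (by norm_num)
  have hB' : ∀ i k, ContDiff ℝ 1 (fderiv ℝ fun v => B v i k) := fun i k =>
    (hw.contDiff_visc i k).fderiv_right (by norm_num)
  simp only [coeffA, jacobian, Matrix.of_apply]
  refine ContDiff.sub ?_ (ContDiff.sum fun k _ => ContDiff.mul ?_ ?_)
  · exact contDiff_pi.1 ((hf'.comp hw.contDiff_wave).clm_apply contDiff_const) i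
  · exact ((hB' i k).comp hw.contDiff_wave).clm_apply contDiff_const
  · exact contDiff_pi.1 hw.contDiff_deriv k

theorem continuous_coeffA : Continuous (coeffA f B ub) :=
  continuous_matrix fun i j => (hw.contDiff_coeffA i j).continuous

theorem continuous_inv_visc : Continuous fun x => (B (ub x))⁻¹ :=
  continuous_matrix fun i j => (contDiffOn_inv_entry (m := 2) hw.contDiff_visc i
    j).continuousOn.comp_continuous hw.continuous hw.det_ne_zero

end IsRegularWave

/-- `ω` is the derivative of the profile with respect to the parameters `(u₋, u₀, s)` at those of
the wave `ub`: it solves the linearized traveling-wave equation, and the profile is strictly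
differentiable with derivative `ω`, uniformly over the period. -/
structure IsVariation (f : State n → State n) (B : State n → Matrix (Fin n) (Fin n) ℝ)
    (ub : ℝ → State n) (um : State n) (T : ℝ) (ω : ℝ → Param n →L[ℝ] State n) : Prop where
  apply_zero : ∀ h, ω 0 h = h.2.1
  hasDerivWithinAt : ∀ t ∈ Icc 0 T, ∀ h, HasDerivWithinAt (fun t => ω t h)
    ((B (ub t))⁻¹ *ᵥ (coeffA f B ub t *ᵥ ω t h - jacobian f um *ᵥ h.1 - h.2.2 • (ub t - um)))
    (Icc 0 T) t
  continuousOn : ContinuousOn ω (Icc 0 T)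
  profile_eq : EqOn (profile f B T um (ub 0) 0) ub (Icc 0 T)
  isSolution : ∀ᶠ y : Param n in 𝓝 (um, ub 0, 0),
    IsSolution f B T y.1 y.2.1 y.2.2 (profile f B T y.1 y.2.1 y.2.2)
  strict : ∀ ε > 0, ∀ᶠ p : Param n × Param n in 𝓝 ((um, ub 0, 0), (um, ub 0, 0)),
    ∀ t ∈ Icc 0 T, ‖profile f B T p.1.1 p.1.2.1 p.1.2.2 t - profile f B T p.2.1 p.2.2.1 p.2.2.2 t -
      ω t (p.1 - p.2)‖ ≤ ε * ‖p.1 - p.2‖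

theorem isSolution_profile {T : ℝ} {v a : State n} {s : ℝ}
    (h : ∃ u, IsSolution f B T v a s u) : IsSolution f B T v a s (profile f B T v a s) := by
  rw [profile, dif_pos h]
  exact h.choose_spec

theorem IsRegularWave.exists_isVariation {ub : ℝ → State n} {um : State n} {T : ℝ}
    (hw : IsRegularWave f B ub um T) : ∃ ω, IsVariation f B ub um T ω := by
  set F := fun y : Param n => field f B y.1 y.2.2 y.2.1 with hF
  have hT := hw.pos.le
  have hcurve : ∀ t ∈ Icc 0 T, HasDerivWithinAt (fun t => ((um, ub t, 0) : Param n))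
      (extendedField f B (um, ub t, 0)) (Icc 0 T) t := fun t _ =>
    ((hasDerivAt_const t um).prodMk
      ((hw.hasDerivAt t).prodMk (hasDerivAt_const t 0))).hasDerivWithinAt
  obtain ⟨u, W, hu, hW0, hW, hstrict⟩ := exists_flow (isOpen_regular hw.contDiff_visc)
    ((contDiffOn_extendedField hw.contDiff_flux hw.contDiff_visc).of_le one_le_two) hT hcurve
    (fun t _ => hw.det_ne_zero t)
  -- a solution of the traveling-wave equation is the middle component of one of the extended system
  have hlift : ∀ {y : Param n} {v : ℝ → State n}, IsSolution f B T y.1 y.2.1 y.2.2 v →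
      ((y.1, v 0, y.2.2) : Param n) = y ∧ ∀ t ∈ Icc 0 T,
        HasDerivWithinAt (fun t => ((y.1, v t, y.2.2) : Param n))
          (extendedField f B (y.1, v t, y.2.2)) (Icc 0 T) t := fun hv =>
    ⟨by rw [hv.1], fun t ht => (hasDerivWithinAt_const t _ _).prodMk
      ((hv.2 t ht).prodMk (hasDerivWithinAt_const t _ _))⟩
  have hproj : ∀ᶠ y : Param n in 𝓝 (um, ub 0, 0),
      IsSolution f B T y.1 y.2.1 y.2.2 (profile f B T y.1 y.2.1 y.2.2) ∧
      EqOn (profile f B T y.1 y.2.1 y.2.2) (fun t => (u y t).2.1) (Icc 0 T) := by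
    filter_upwards [hu] with y hy
    obtain ⟨hy0, hyd, hyu⟩ := hy
    have hconst : ∀ t ∈ Icc 0 T, (u y t).1 = y.1 ∧ (u y t).2.2 = y.2.2 := by
      have h1 : ∀ t ∈ Icc 0 T, HasDerivWithinAt (fun t => (u y t).1) 0 (Icc 0 T) t :=
        fun t ht => (hyd t ht).clm_map (ContinuousLinearMap.fst ℝ _ _)
      have h2 : ∀ t ∈ Icc 0 T, HasDerivWithinAt (fun t => (u y t).2.2) 0 (Icc 0 T) t :=
        fun t ht => (hyd t ht).clm_map (ContinuousLinearMap.snd ℝ _ _ ∘L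
          ContinuousLinearMap.snd ℝ _ _)
      intro t ht
      constructor
      · have := constant_of_has_deriv_right_zero (fun t ht => (h1 t ht).continuousWithinAt)
          (fun t ht => (h1 t (Ico_subset_Icc_self ht)).Ici_of_Icc ht) t ht
        rw [this, hy0]
      · have := constant_of_has_deriv_right_zero (fun t ht => (h2 t ht).continuousWithinAt)
          (fun t ht => (h2 t (Ico_subset_Icc_self ht)).Ici_of_Icc ht) t ht
        rw [this, hy0]
    have hsol : IsSolution f B T y.1 y.2.1 y.2.2 (fun t => (u y t).2.1) := by
      refine ⟨congrArg (fun z : Param n => z.2.1) hy0, fun t ht => ?_⟩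
      have h3 : HasDerivWithinAt (fun t => (u y t).2.1) (extendedField f B (u y t)).2.1
          (Icc 0 T) t := (hyd t ht).clm_map (ContinuousLinearMap.fst ℝ _ _ ∘L
            ContinuousLinearMap.snd ℝ _ _)
      simpa [extendedField, (hconst t ht).1, (hconst t ht).2] using h3
    have hprof := isSolution_profile ⟨_, hsol⟩
    refine ⟨hprof, fun t ht => ?_⟩
    have := hyu _ (hlift hprof).1 (hlift hprof).2 ht
    exact congrArg (fun z : Param n => z.2.1) this
  have hWd : ∀ t ∈ Icc 0 T, ∀ h, HasDerivWithinAt (fun t => W t h)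
      ((0, fderiv ℝ F (um, ub t, 0) (W t h), 0) : Param n) (Icc 0 T) t := by
    intro t ht h
    have hG : HasFDerivAt (extendedField f B) ((0 : Param n →L[ℝ] State n).prod
        ((fderiv ℝ F (um, ub t, 0)).prod (0 : Param n →L[ℝ] ℝ))) (um, ub t, 0) :=
      (hasFDerivAt_const _ _).prodMk
        ((hw.differentiableAt_field t).hasFDerivAt.prodMk (hasFDerivAt_const _ _))
    have := (hW t ht).clm_map (ContinuousLinearMap.apply ℝ (Param n) h)
    rw [hG.fderiv] at this
    simpa using this
  have hWconst : ∀ t ∈ Icc 0 T, ∀ h : Param n, (W t h).1 = h.1 ∧ (W t h).2.2 = h.2.2 := by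
    intro t ht h
    have h1 : ∀ t ∈ Icc 0 T, HasDerivWithinAt (fun t => (W t h).1) 0 (Icc 0 T) t :=
      fun t ht => (hWd t ht h).clm_map (ContinuousLinearMap.fst ℝ _ _)
    have h2 : ∀ t ∈ Icc 0 T, HasDerivWithinAt (fun t => (W t h).2.2) 0 (Icc 0 T) t :=
      fun t ht => (hWd t ht h).clm_map (ContinuousLinearMap.snd ℝ _ _ ∘L
        ContinuousLinearMap.snd ℝ _ _)
    constructor
    · have := constant_of_has_deriv_right_zero (fun t ht => (h1 t ht).continuousWithinAt)
        (fun t ht => (h1 t (Ico_subset_Icc_self ht)).Ici_of_Icc ht) t ht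
      simpa [hW0] using this
    · have := constant_of_has_deriv_right_zero (fun t ht => (h2 t ht).continuousWithinAt)
        (fun t ht => (h2 t (Ico_subset_Icc_self ht)).Ici_of_Icc ht) t ht
      simpa [hW0] using this
  refine ⟨fun t => (ContinuousLinearMap.fst ℝ (State n) ℝ ∘L
    ContinuousLinearMap.snd ℝ (State n) (State n × ℝ)) ∘L W t, ?_, ?_, ?_, ?_,
    hproj.mono fun y hy => hy.1, ?_⟩
  · intro h
    simp [hW0]
  · intro t ht h
    have := (hWd t ht h).clm_map (ContinuousLinearMap.fst ℝ (State n) ℝ ∘L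
      ContinuousLinearMap.snd ℝ (State n) (State n × ℝ))
    have e := hw.fderiv_field t (W t h)
    rw [(hWconst t ht h).1, (hWconst t ht h).2] at e
    rw [← hF] at e
    exact this.congr_deriv e
  · exact continuousOn_const.clm_comp fun t ht => (hW t ht).continuousWithinAt
  · have h0 := hproj.self_of_nhds
    have hub : IsSolution f B T um (ub 0) 0 ub :=
      ⟨rfl, fun t _ => (hw.hasDerivAt t).hasDerivWithinAt⟩
    obtain ⟨-, -, huniq⟩ := hu.self_of_nhds
    intro t ht
    rw [h0.2 ht]
    exact (congrArg (fun z : Param n => z.2.1) (huniq _ rfl hcurve ht)).symm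
  · intro ε hε
    obtain ⟨δ, hδ, hst⟩ := hstrict ε hε
    have hball := Metric.ball_mem_nhds ((um, ub 0, 0) : Param n) hδ
    filter_upwards [prod_mem_nhds (inter_mem hball hproj) (inter_mem hball hproj)] with p hp t ht
    obtain ⟨⟨hp1, -, hp2⟩, hq1, -, hq2⟩ := hp
    have := hst p.1 p.2 hp1 hq1 t ht
    rw [hp2 ht, hq2 ht]
    refine le_trans ?_ this
    exact (norm_fst_le _).trans (norm_snd_le (u p.1 t - u p.2 t - W t (p.1 - p.2)))

end PeriodicWave

namespace PeriodicWave

variable {n : ℕ} {f : State n → State n} {B : State n → Matrix (Fin n) (Fin n) ℝ}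
  {ub : ℝ → State n} {um : State n} {T : ℝ}

/-! ### The variations of the profile -/

namespace IsVariation

variable {ω : ℝ → Param n →L[ℝ] State n} (hω : IsVariation f B ub um T ω)
include hω

theorem hasStrictFDerivAt {t : ℝ} (ht : t ∈ Icc 0 T) :
    HasStrictFDerivAt (fun y : Param n => profile f B T y.1 y.2.1 y.2.2 t) (ω t)
      (um, ub 0, 0) := by
  refine HasStrictFDerivAt.of_isLittleO (isLittleO_iff.2 fun ε hε => ?_)
  filter_upwards [hω.strict ε hε] with p hp
  exact hp t ht

theorem varInit_eq {t : ℝ} (ht : t ∈ Icc 0 T) (h : State n) :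
    varInit f B T um (ub 0) h t = ω t (0, h, 0) := by
  have := (hω.hasStrictFDerivAt ht).hasFDerivAt.comp (ub 0) (f := fun v => ((um, v, 0) : Param n))
    ((hasFDerivAt_const um (ub 0)).prodMk ((hasFDerivAt_id (ub 0)).prodMk
      (hasFDerivAt_const (0 : ℝ) (ub 0))))
  exact congrArg (fun L => L h) this.fderiv

theorem varRest_eq {t : ℝ} (ht : t ∈ Icc 0 T) (h : State n) :
    varRest f B T um (ub 0) h t = ω t (h, 0, 0) := by
  have := (hω.hasStrictFDerivAt ht).hasFDerivAt.comp um (f := fun v => ((v, ub 0, 0) : Param n))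
    ((hasFDerivAt_id um).prodMk ((hasFDerivAt_const (ub 0) um).prodMk
      (hasFDerivAt_const (0 : ℝ) um)))
  exact congrArg (fun L => L h) this.fderiv

theorem varSpeed_eq {t : ℝ} (ht : t ∈ Icc 0 T) :
    varSpeed f B T um (ub 0) t = -ω t (0, 0, 1) := by
  have := (hω.hasStrictFDerivAt ht).hasFDerivAt.comp_hasDerivAt (0 : ℝ)
    ((hasDerivAt_const (0 : ℝ) um).prodMk ((hasDerivAt_const (0 : ℝ) (ub 0)).prodMk
      (hasDerivAt_id (0 : ℝ))))
  exact congrArg Neg.neg this.deriv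

/-- The variation in the direction `ū'(0)` of the initial value is `ū'`, the derivative of the
profile along its orbit. -/
theorem apply_deriv (hw : IsRegularWave f B ub um T) {t : ℝ} (ht : t ∈ Icc 0 T) :
    ω t (0, deriv ub 0, 0) = deriv ub t := by
  refine linear_solution_unique_Icc (c := 0) (u := fun t => ω t (0, deriv ub 0, 0))
    (continuous_mulVecCLM (hw.continuous_inv_visc.mul hw.continuous_coeffA))
    (fun t ht => (hω.hasDerivWithinAt t ht _).congr_deriv ?_)
    (fun t _ => (hw.hasDerivAt_deriv t).hasDerivWithinAt.congr_deriv ?_)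
    (by simp [hω.apply_zero]) ht <;> simp

theorem continuousOn_apply (h : Param n) : ContinuousOn (fun t => ω t h) (Icc 0 T) :=
  hω.continuousOn.clm_apply continuousOn_const

/-- The derivative of the separation function. -/
theorem hasStrictFDerivAt_separation (hT : 0 ≤ T) :
    HasStrictFDerivAt (fun y : Param n => separation f B T y.1 y.2.1 y.2.2) (ω T - ω 0)
      (um, ub 0, 0) :=
  (hω.hasStrictFDerivAt (right_mem_Icc.2 hT)).sub (hω.hasStrictFDerivAt (left_mem_Icc.2 hT))

/-- The mass of the profile is differentiable in the parameters. -/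
theorem hasFDerivAt_integral (hT : 0 ≤ T) :
    HasFDerivAt (fun y : Param n => ∫ x in (0 : ℝ)..T, profile f B T y.1 y.2.1 y.2.2 x)
      (∫ x in (0 : ℝ)..T, ω x) (um, ub 0, 0) := by
  have hint : ∀ {g : ℝ → State n}, ContinuousOn g (Icc 0 T) →
      IntervalIntegrable g MeasureTheory.volume 0 T := fun hg =>
    ContinuousOn.intervalIntegrable (by rwa [uIcc_of_le hT])
  have hωi : IntervalIntegrable ω MeasureTheory.volume 0 T :=
    ContinuousOn.intervalIntegrable (by rw [uIcc_of_le hT]; exact hω.continuousOn)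
  have hcont : ∀ {y : Param n},
      IsSolution f B T y.1 y.2.1 y.2.2 (profile f B T y.1 y.2.1 y.2.2) →
      ContinuousOn (profile f B T y.1 y.2.1 y.2.2) (Icc 0 T) :=
    fun h t ht => (h.2 t ht).continuousWithinAt
  refine HasFDerivAt.of_isLittleO (isLittleO_iff.2 fun ε hε => ?_)
  have hε' : 0 < ε / (T + 1) := by positivity
  have hst := (hω.strict _ hε').curry_nhds.mono fun p hp => hp.self_of_nhds
  have hst' : ∀ᶠ y : Param n in 𝓝 (um, ub 0, 0), ∀ t ∈ Icc 0 T,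
      ‖profile f B T y.1 y.2.1 y.2.2 t - profile f B T um (ub 0) 0 t - ω t (y - (um, ub 0, 0))‖ ≤
        ε / (T + 1) * ‖y - (um, ub 0, 0)‖ := hst
  filter_upwards [hst', hω.isSolution] with y hy hsol
  have hsol0 := hω.isSolution.self_of_nhds
  rw [ContinuousLinearMap.intervalIntegral_apply hωi, ← intervalIntegral.integral_sub
    (hint (hcont hsol)) (hint (hcont hsol0)), ← intervalIntegral.integral_sub
    ((hint (hcont hsol)).sub (hint (hcont hsol0))) (hint (hω.continuousOn_apply _))]
  refine (intervalIntegral.norm_integral_le_of_norm_le_const (C := ε / (T + 1) *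
    ‖y - (um, ub 0, 0)‖) fun x hx => ?_).trans ?_
  · rw [uIoc_of_le hT] at hx
    exact hy x (Ioc_subset_Icc_self hx)
  · rw [sub_zero, abs_of_nonneg hT]
    have : ε / (T + 1) * T ≤ ε := by
      rw [div_mul_eq_mul_div, div_le_iff₀ (by linarith)]; nlinarith
    nlinarith [norm_nonneg (y - (um, ub 0, 0))]

end IsVariation

end PeriodicWave

namespace PeriodicWave

variable {n : ℕ} [NeZero n] {f : State n → State n} {B : State n → Matrix (Fin n) (Fin n) ℝ}
  {ub : ℝ → State n} {um : State n} {T : ℝ}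

/-! ### Transversality and the family of periodic waves -/

/-- The coordinates of a variation of `(u₀, s)` with respect to `z̃₁, w₂, …, wₙ`; the component of
`u₀` along `b 0`, a translation of the wave, is left out. -/
noncomputable def transverseCoord (b : Module.Basis (Fin n) ℝ (State n)) (a : State n) (s : ℝ)
    (k : Fin n) : ℝ :=
  if k = 0 then -s else b.repr a k

omit [NeZero n] in
theorem IsRegularWave.deriv_period {T : ℝ} (hw : IsRegularWave f B ub um T) :
    deriv ub T = deriv ub 0 := by
  rw [hw.deriv_eq, hw.deriv_eq, ← hw.periodic 0, zero_add]

namespace IsVariation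

variable {ω : ℝ → Param n →L[ℝ] State n} (hω : IsVariation f B ub um T ω)
  (hw : IsRegularWave f B ub um T)
  {b : Module.Basis (Fin n) ℝ (State n)} (hb : b 0 = deriv ub 0)
include hω hw hb

omit hw hb in
theorem transverse_eq {t : ℝ} (ht : t ∈ Icc 0 T) (k : Fin n) :
    transverse f B T um (ub 0) b k t = if k = 0 then -ω t (0, 0, 1) else ω t (0, b k, 0) := by
  rw [transverse]
  split_ifs
  · exact hω.varSpeed_eq ht
  · exact hω.varInit_eq ht _

theorem apply_eq_sum {t : ℝ} (ht : t ∈ Icc 0 T) (a : State n) (s : ℝ) :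
    ω t (0, a, s) = b.repr a 0 • deriv ub t +
      ∑ k, transverseCoord b a s k • transverse f B T um (ub 0) b k t := by
  have hsplit : ((0, a, s) : Param n) = (0, a, 0) + s • (0, 0, 1) := by simp
  have ha : ω t (0, a, 0) = ∑ k, b.repr a k • ω t (0, b k, 0) := by
    have : ((0, a, 0) : Param n) = ∑ k, b.repr a k • ((0, b k, 0) : Param n) := by
      conv_lhs => rw [← b.sum_repr a]
      simp [Prod.ext_iff, Prod.fst_sum, Prod.snd_sum]
    rw [this, map_sum]
    simp only [map_smul]
  rw [hsplit, map_add, map_smul, ha, ← Finset.add_sum_erase _ _ (Finset.mem_univ (0 : Fin n)),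
    ← Finset.add_sum_erase (a := (0 : Fin n)) _ (fun k => transverseCoord b a s k • _)
      (Finset.mem_univ _), hb, hω.apply_deriv hw ht, hω.transverse_eq ht]
  have : ∀ k ∈ Finset.univ.erase (0 : Fin n), b.repr a k • ω t (0, b k, 0) =
      transverseCoord b a s k • transverse f B T um (ub 0) b k t := fun k hk => by
    rw [hω.transverse_eq ht, transverseCoord, if_neg (Finset.ne_of_mem_erase hk),
      if_neg (Finset.ne_of_mem_erase hk)]
  rw [Finset.sum_congr rfl this]
  simp [transverseCoord]
  abel

theorem jump_eq_sum (a : State n) (s : ℝ) :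
    (ω T - ω 0) (0, a, s) =
      ∑ k, transverseCoord b a s k • jump T (transverse f B T um (ub 0) b k) := by
  have hT := hw.pos.le
  rw [_root_.sub_apply, hω.apply_eq_sum hw hb (right_mem_Icc.2 hT),
    hω.apply_eq_sum hw hb (left_mem_Icc.2 hT), hw.deriv_period]
  simp only [jump, smul_sub, Finset.sum_sub_distrib]
  abel

/-- The `n` jumps span the range of the derivative of the separation function, because the
remaining direction, the translation, has no jump. -/
theorem gammaCoeff_ne_zero (H3 : Transversal f B T um (ub 0)) :
    gammaCoeff f B T um (ub 0) b ≠ 0 := by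
  have hT := hw.pos.le
  have hfd : ∀ p : State n × ℝ,
      fderiv ℝ (fun p : State n × ℝ => separation f B T um p.1 p.2) (ub 0, 0) p =
        (ω T - ω 0) (0, p.1, p.2) := by
    intro p
    have := (hω.hasStrictFDerivAt_separation hT).hasFDerivAt.comp (ub 0, (0 : ℝ))
      (f := fun p : State n × ℝ => ((um, p) : Param n))
      ((hasFDerivAt_const um (ub 0, (0 : ℝ))).prodMk (hasFDerivAt_id (ub 0, (0 : ℝ))))
    exact congrArg (fun L => L p) this.fderiv
  set t := fun i => jump T (transverse f B T um (ub 0) b i) with ht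
  have hspan : ⊤ ≤ Submodule.span ℝ (range t) := by
    rintro x -
    obtain ⟨p, rfl⟩ := H3 x
    rw [hfd, hω.jump_eq_sum hw hb]
    exact Submodule.sum_mem _ fun k _ =>
      Submodule.smul_mem _ _ (Submodule.subset_span (mem_range_self k))
  have hli := linearIndependent_of_top_le_span_of_card_eq_finrank hspan (by simp)
  exact ((Module.Basis.is_basis_iff_det b).1 ⟨hli, top_le_iff.1 hspan⟩).ne_zero

end IsVariation

/-- The derivative, in the parameters `(u₋, u₀, s)`, of the separation function together with the
phase `b.repr u₀ 0`, in terms of the variation `ω` of the profile. -/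
noncomputable def periodicityDeriv (b : Module.Basis (Fin n) ℝ (State n)) (T : ℝ)
    (ω : ℝ → Param n →L[ℝ] State n) : Param n →L[ℝ] State n × ℝ :=
  (ω T - ω 0).prod (LinearMap.toContinuousLinearMap (b.coord 0) ∘L
    ContinuousLinearMap.fst ℝ (State n) ℝ ∘L ContinuousLinearMap.snd ℝ (State n) (State n × ℝ))

/-- The standard determinant of the jumps is `γ` times that of the basis `b`. -/
theorem det_transverseMatrix (b : Module.Basis (Fin n) ℝ (State n)) (u0 : State n) :
    (transverseMatrix f B T um u0 b).det =
      ((Pi.basisFun ℝ (Fin n)).toMatrix b).det * gammaCoeff f B T um u0 b := by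
  rw [gammaCoeff, Module.Basis.det_apply, ← Matrix.det_mul,
    Module.Basis.toMatrix_mul_toMatrix]
  rfl

omit [NeZero n] in
theorem det_basis_ne_zero (b : Module.Basis (Fin n) ℝ (State n)) :
    ((Pi.basisFun ℝ (Fin n)).toMatrix b).det ≠ 0 := by
  rw [← Module.Basis.det_apply]
  exact ((Pi.basisFun ℝ (Fin n)).isUnit_det b).ne_zero

theorem isUnit_det_transverseMatrix {b : Module.Basis (Fin n) ℝ (State n)} {u0 : State n}
    (hγ : gammaCoeff f B T um u0 b ≠ 0) : IsUnit (transverseMatrix f B T um u0 b).det := by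
  rw [det_transverseMatrix]
  exact isUnit_iff_ne_zero.2 (mul_ne_zero (det_basis_ne_zero b) hγ)

theorem transverseMatrix_mulVec (b : Module.Basis (Fin n) ℝ (State n)) (u0 : State n)
    (c : Fin n → ℝ) : transverseMatrix f B T um u0 b *ᵥ c =
      ∑ k, c k • jump T (transverse f B T um u0 b k) := by
  ext i
  simp [transverseMatrix, Matrix.mulVec, dotProduct, mul_comm]

namespace IsVariation

variable {ω : ℝ → Param n →L[ℝ] State n} (hω : IsVariation f B ub um T ω)
  (hw : IsRegularWave f B ub um T)
  {b : Module.Basis (Fin n) ℝ (State n)} (hb : b 0 = deriv ub 0)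
  (hγ : gammaCoeff f B T um (ub 0) b ≠ 0)
include hω hw hb hγ

/-- A variation of the parameters that keeps the wave periodic and fixes the phase is the adjusted
variation. -/
theorem apply_eq_adjusted {j : Fin n} {a : State n} {s : ℝ}
    (hjump : (ω T - ω 0) (Pi.single j 1, a, s) = 0) (ha : b.repr a 0 = 0)
    {t : ℝ} (ht : t ∈ Icc 0 T) :
    ω t (Pi.single j 1, a, s) = adjusted f B T um (ub 0) b j t := by
  have hT := hw.pos.le
  have hsplit : ((Pi.single j 1, a, s) : Param n) = (Pi.single j 1, 0, 0) + (0, a, s) := by simp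
  have hdet := isUnit_det_transverseMatrix hγ
  have hrest : jump T (varRest f B T um (ub 0) (Pi.single j 1)) =
      (ω T - ω 0) (Pi.single j 1, 0, 0) := by
    rw [jump, hω.varRest_eq (right_mem_Icc.2 hT), hω.varRest_eq (left_mem_Icc.2 hT)]; rfl
  rw [hsplit, map_add, hω.jump_eq_sum hw hb, ← transverseMatrix_mulVec, ← hrest] at hjump
  have hc : (transverseMatrix f B T um (ub 0) b)⁻¹ *ᵥ
      jump T (varRest f B T um (ub 0) (Pi.single j 1)) = -transverseCoord b a s := by
    rw [eq_neg_of_add_eq_zero_left hjump, Matrix.mulVec_neg, Matrix.mulVec_mulVec,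
      Matrix.nonsing_inv_mul _ hdet, Matrix.one_mulVec]
  rw [hsplit, map_add, hω.apply_eq_sum hw hb ht, ha, zero_smul, zero_add, adjusted, hc,
    hω.varRest_eq ht]
  simp

omit hb hγ in
/-- The defining equations of the periodic family as one map of the parameters. -/
theorem hasStrictFDerivAt_periodicity :
    HasStrictFDerivAt (fun y : Param n =>
      (separation f B T y.1 y.2.1 y.2.2, b.repr y.2.1 0 - b.repr (ub 0) 0))
      (periodicityDeriv b T ω) (um, ub 0, 0) :=
  (hω.hasStrictFDerivAt_separation hw.pos.le).prodMk
    (((LinearMap.toContinuousLinearMap (b.coord 0) ∘L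
        ContinuousLinearMap.fst ℝ (State n) ℝ ∘L
          ContinuousLinearMap.snd ℝ (State n) (State n × ℝ)).hasStrictFDerivAt).sub_const _)

/-- Fixing the phase removes the translation `ū'(0)` from the kernel of the derivative with respect
to `(u₀, s)`; on the other directions it is injective because `γ ≠ 0`. -/
theorem isInvertible_periodicity :
    (periodicityDeriv b T ω ∘L
      ContinuousLinearMap.inr ℝ (State n) (State n × ℝ)).IsInvertible := by
  set L := periodicityDeriv b T ω ∘L ContinuousLinearMap.inr ℝ (State n) (State n × ℝ) with hL
  have hdet := isUnit_det_transverseMatrix hγ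
  have hinj : Function.Injective L.toLinearMap := by
    rw [← LinearMap.ker_eq_bot, LinearMap.ker_eq_bot']
    rintro ⟨a, s⟩ h
    have h1 : (ω T - ω 0) (0, a, s) = 0 := congrArg Prod.fst h
    have h2 : b.repr a 0 = 0 := congrArg Prod.snd h
    rw [hω.jump_eq_sum hw hb, ← transverseMatrix_mulVec] at h1
    have hc : transverseCoord b a s = 0 := by
      have := congrArg ((transverseMatrix f B T um (ub 0) b)⁻¹ *ᵥ ·) h1
      simpa [Matrix.mulVec_mulVec, Matrix.nonsing_inv_mul _ hdet] using this
    have hs : s = 0 := by simpa [transverseCoord] using congrFun hc 0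
    have ha : a = 0 := by
      refine b.ext_elem fun k => ?_
      by_cases hk : k = 0
      · simpa [hk] using h2
      · simpa [transverseCoord, hk] using congrFun hc k
    rw [ha, hs]; rfl
  exact ⟨(LinearEquiv.ofInjectiveEndo _ hinj).toContinuousLinearEquiv, by ext <;> rfl⟩

/-- The periodic waves near the given one form a differentiable family, unique as a germ. -/
theorem exists_family : ∃ (ψ : State n → State n × ℝ) (ψ' : State n →L[ℝ] State n × ℝ),
    IsPeriodicFamily f B T um (ub 0) b ψ ∧ HasFDerivAt ψ ψ' um ∧
    (∀ σ, IsPeriodicFamily f B T um (ub 0) b σ → σ =ᶠ[𝓝 um] ψ) ∧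
    ∀ h, (ω T - ω 0) (h, ψ' h) = 0 ∧ b.repr (ψ' h).1 0 = 0 := by
  have hT := hw.pos.le
  have hst := hω.hasStrictFDerivAt_periodicity hw (b := b)
  have hinv := hω.isInvertible_periodicity hw hb hγ
  set Γ : Param n → State n × ℝ := fun y =>
    (separation f B T y.1 y.2.1 y.2.2, b.repr y.2.1 0 - b.repr (ub 0) 0) with hΓ
  have hΓ0 : Γ (um, ub 0, 0) = 0 := by
    have h1 := hω.profile_eq (right_mem_Icc.2 hT)
    have h2 := hω.profile_eq (left_mem_Icc.2 hT)
    have h3 : ub T = ub 0 := by rw [← hw.periodic 0, zero_add]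
    simp [hΓ, separation, jump, h1, h2, h3]
  set ψ := hst.implicitFunctionOfProdDomain hinv with hψ
  have hψd := (hst.hasStrictFDerivAt_implicitFunctionOfProdDomain hinv).hasFDerivAt
  have hψ0 : ψ um = (ub 0, 0) :=
    (hst.eventually_apply_eq_iff_implicitFunctionOfProdDomain hinv).self_of_nhds.1 rfl
  have hψs : ∀ᶠ v in 𝓝 um, Γ (v, ψ v) = 0 := by
    filter_upwards [hst.eventually_apply_implicitFunctionOfProdDomain hinv] with v hv
    rw [← hΓ0]; exact hv
  refine ⟨ψ, _, ⟨hψ0, hψd.continuousAt, ?_⟩, hψd, ?_, ?_⟩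
  · filter_upwards [hψs] with v hv
    exact ⟨congrArg Prod.fst hv, sub_eq_zero.1 (congrArg Prod.snd hv)⟩
  · rintro σ ⟨hσ0, hσc, hσ⟩
    have htend : Tendsto (fun v => ((v, σ v) : Param n)) (𝓝 um) (𝓝 (um, ub 0, 0)) := by
      rw [← hσ0]; exact continuousAt_id.prodMk hσc
    filter_upwards [hσ, htend.eventually
      (hst.eventually_apply_eq_iff_implicitFunctionOfProdDomain hinv)] with v hv hiff
    refine (hiff.1 ?_).symm
    rw [hΓ0]
    exact Prod.ext hv.1 (sub_eq_zero.2 hv.2)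
  · have hst' : HasFDerivAt Γ (periodicityDeriv b T ω) (um, ψ um) := by
      rw [hψ0]; exact hst.hasFDerivAt
    have hcomp := hst'.comp um (f := fun v => ((v, ψ v) : Param n))
      ((hasFDerivAt_id um).prodMk hψd)
    have hzero := hcomp.unique ((hasFDerivAt_const (0 : State n × ℝ) um).congr_of_eventuallyEq hψs)
    intro h
    have := congrArg (fun L => L h) hzero
    exact ⟨congrArg Prod.fst this, congrArg Prod.snd this⟩

/-- The derivative of the mass along the periodic family has the determinant `Δ`. -/
theorem mass_family {σ : State n → State n × ℝ} (hσ : IsPeriodicFamily f B T um (ub 0) b σ) :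
    DifferentiableAt ℝ (mass f B T σ) um ∧
      (jacobian (mass f B T σ) um).det = deltaCoeff f B T um (ub 0) b := by
  have hT := hw.pos.le
  obtain ⟨ψ, ψ', -, hψd, huniq, hψ'⟩ := hω.exists_family hw hb hγ
  have hσd : HasFDerivAt σ ψ' um := hψd.congr_of_eventuallyEq (huniq σ hσ)
  have hI : HasFDerivAt (fun y : Param n => ∫ x in (0 : ℝ)..T, profile f B T y.1 y.2.1 y.2.2 x)
      (∫ x in (0 : ℝ)..T, ω x) (um, σ um) := by rw [hσ.1]; exact hω.hasFDerivAt_integral hT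
  have hm : HasFDerivAt (mass f B T σ)
      ((∫ x in (0 : ℝ)..T, ω x) ∘L (ContinuousLinearMap.id ℝ (State n)).prod ψ') um :=
    hI.comp um (f := fun v => ((v, σ v) : Param n)) ((hasFDerivAt_id um).prodMk hσd)
  refine ⟨hm.differentiableAt, ?_⟩
  rw [deltaCoeff]
  congr 1
  ext i j
  rw [jacobian, Matrix.of_apply, Matrix.of_apply, hm.fderiv]
  have hωi : IntervalIntegrable ω MeasureTheory.volume 0 T :=
    ContinuousOn.intervalIntegrable (by rw [uIcc_of_le hT]; exact hω.continuousOn)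
  have : (∫ x in (0 : ℝ)..T, ω x) (Pi.single j 1, ψ' (Pi.single j 1)) =
      ∫ x in (0 : ℝ)..T, adjusted f B T um (ub 0) b j x := by
    rw [ContinuousLinearMap.intervalIntegral_apply hωi]
    refine intervalIntegral.integral_congr fun x hx => ?_
    rw [uIcc_of_le hT] at hx
    exact hω.apply_eq_adjusted hw hb hγ (hψ' _).1 (hψ' _).2 hx
  exact congrFun this i

end IsVariation

end PeriodicWave

/-! ### Linear systems with a complex parameter -/

namespace PeriodicWave

section LinearSystem

variable {ι : Type} [Fintype ι]

/-- A complex matrix as a real-linear operator. -/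
noncomputable def mulVecReal (A : Matrix ι ι ℂ) : (ι → ℂ) →L[ℝ] (ι → ℂ) :=
  (LinearMap.toContinuousLinearMap A.mulVecLin).restrictScalars ℝ

@[simp] theorem mulVecReal_apply (A : Matrix ι ι ℂ) (v : ι → ℂ) : mulVecReal A v = A *ᵥ v := rfl

theorem continuous_mulVecReal {A : ℝ → Matrix ι ι ℂ} (hA : Continuous A) :
    Continuous fun t => mulVecReal (A t) :=
  (ContinuousLinearMap.continuous_restrictScalars ℝ).comp (continuous_mulVecCLM hA)

theorem exists_system_solution {A : ℝ → Matrix ι ι ℂ} (hA : Continuous A) {g : ℝ → ι → ℂ}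
    (hg : Continuous g) (v₀ : ι → ℂ) :
    ∃ v : ℝ → ι → ℂ, v 0 = v₀ ∧ ∀ t, HasDerivAt v (A t *ᵥ v t + g t) t :=
  exists_linear_solution (continuous_mulVecReal hA) hg v₀

theorem exists_isFundamental [DecidableEq ι] {A : ℝ → Matrix ι ι ℂ} (hA : Continuous A) :
    ∃ Ψ, IsFundamental A Ψ := by
  choose u hu0 hu using fun j : ι =>
    exists_system_solution hA (continuous_const (y := 0)) (Pi.single j (1 : ℂ))
  refine ⟨fun x => Matrix.of fun i j => u j x i, ?_, fun x i j => ?_⟩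
  · ext i j
    simp [hu0, Matrix.one_apply, Pi.single_apply]
  · have := hasDerivAt_pi.1 (hu j x) i
    simpa [Matrix.mul_apply, Matrix.mulVec, dotProduct] using this

theorem isFundamental_fundamental [DecidableEq ι] {A : ℝ → Matrix ι ι ℂ} (hA : Continuous A) :
    IsFundamental A (fundamental A) := by
  rw [fundamental, dif_pos (exists_isFundamental hA)]
  exact (exists_isFundamental hA).choose_spec

theorem IsFundamental.mulVec_eq [DecidableEq ι] {A Ψ : ℝ → Matrix ι ι ℂ} (hΨ : IsFundamental A Ψ)
    (hA : Continuous A) {y : ℝ → ι → ℂ} (hy : ∀ t, HasDerivAt y (A t *ᵥ y t) t) (t : ℝ) :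
    y t = Ψ t *ᵥ y 0 := by
  have hΨd : ∀ t, HasDerivAt (fun t => Ψ t *ᵥ y 0) (A t *ᵥ (Ψ t *ᵥ y 0)) t := by
    intro t
    rw [Matrix.mulVec_mulVec, hasDerivAt_pi]
    intro i
    simp only [Matrix.mulVec, dotProduct]
    exact HasDerivAt.fun_sum fun j _ => (hΨ.2 t i j).mul_const _
  refine linear_solution_unique (c := 0) (continuous_mulVecReal hA) (a := -|t| - 1) (b := |t| + 1)
    (u := y) (v := fun t => Ψ t *ᵥ y 0)
    ⟨by linarith [abs_nonneg t], by linarith [abs_nonneg t]⟩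
    (fun s _ => (hy s).congr_deriv (by simp)) (fun s _ => (hΨd s).congr_deriv (by simp))
    (by simp [hΨ.1]) ⟨by linarith [neg_abs_le t], by linarith [le_abs_self t]⟩

/-- Solutions of a linear system that depends affinely on a complex parameter `l` are complex
differentiable in `l`, uniformly over a compact time interval. -/
theorem system_expansion {A : ℝ → Matrix ι ι ℂ} (hA : Continuous A) (J : Matrix ι ι ℂ)
    {g : ℝ → ι → ℂ} {V : ℂ → ℝ → ι → ℂ} {v₀ : ι → ℂ} (hV0 : ∀ l, V l 0 = v₀)
    (hV : ∀ l t, HasDerivAt (V l) ((A t + l • J) *ᵥ V l t + g t) t) {T : ℝ} (hT : 0 ≤ T) (l₀ : ℂ) :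
    ∃ (Z : ℝ → ι → ℂ) (C : ℝ), Continuous Z ∧ ∀ l, ‖l - l₀‖ ≤ 1 → ∀ t ∈ Icc 0 T,
      ‖V l t - V l₀ t - (l - l₀) • Z t‖ ≤ C * ‖l - l₀‖ ^ 2 := by
  have hA' : ∀ l : ℂ, Continuous fun t => A t + l • J := fun l => hA.add continuous_const
  have hVc : ∀ l, Continuous (V l) := fun l =>
    continuous_iff_continuousAt.2 fun t => (hV l t).continuousAt
  have hJc : Continuous fun t => J *ᵥ V l₀ t := continuous_const.matrix_mulVec (hVc l₀)
  obtain ⟨Z, hZ0, hZ⟩ := exists_system_solution (hA' l₀) hJc 0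
  obtain ⟨K, hK⟩ := isCompact_Icc.exists_bound_of_continuousOn (s := Icc 0 T)
    (continuous_mulVecReal hA).continuousOn
  obtain ⟨M, hM⟩ := isCompact_Icc.exists_bound_of_continuousOn (s := Icc 0 T) hJc.continuousOn
  have h0T : (0 : ℝ) ∈ Icc 0 T := left_mem_Icc.2 hT
  have hK0 : 0 ≤ K := (norm_nonneg _).trans (hK 0 h0T)
  have hM0 : 0 ≤ M := (norm_nonneg _).trans (hM 0 h0T)
  set j := ‖mulVecReal J‖ with hj
  have hj0 : 0 ≤ j := norm_nonneg _
  have hJle : ∀ v, ‖J *ᵥ v‖ ≤ j * ‖v‖ := fun v => (mulVecReal J).le_opNorm v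
  set κ := K + (‖l₀‖ + 1) * j with hκ
  have hκ0 : 0 ≤ κ := by positivity
  have hbd : ∀ l : ℂ, ‖l - l₀‖ ≤ 1 → ∀ t ∈ Icc 0 T, ∀ v, ‖(A t + l • J) *ᵥ v‖ ≤ κ * ‖v‖ := by
    intro l hl t ht v
    have hl' : ‖l‖ ≤ ‖l₀‖ + 1 := by
      have := norm_add_le (l - l₀) l₀
      rw [sub_add_cancel] at this
      linarith
    rw [Matrix.add_mulVec, Matrix.smul_mulVec, hκ, add_mul, mul_assoc]
    refine (norm_add_le _ _).trans (add_le_add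
      ((mulVecReal (A t)).le_of_opNorm_le (hK t ht) v) ?_)
    rw [norm_smul]
    exact mul_le_mul hl' (hJle v) (norm_nonneg _) (by positivity)
  set γ := gronwallBound 0 κ 1 T with hγ
  have hγ0 : 0 ≤ γ := gronwallBound_zero_one_nonneg hκ0 hT
  refine ⟨Z, j * (M * γ) * γ, continuous_iff_continuousAt.2 fun t => (hZ t).continuousAt,
    fun l hl t ht => ?_⟩
  have hd : ∀ t ∈ Icc 0 T, ‖V l t - V l₀ t‖ ≤ ‖l - l₀‖ * M * γ := by
    intro t ht
    have := norm_le_of_norm_deriv_le (g := fun t => V l t - V l₀ t) (ε := ‖l - l₀‖ * M)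
      hκ0 le_rfl (by positivity)
      (fun t _ => ((hV l t).sub (hV l₀ t)).hasDerivWithinAt) (by simp [hV0])
      (fun t ht => by
        have e : (A t + l • J) *ᵥ V l t + g t - ((A t + l₀ • J) *ᵥ V l₀ t + g t) =
            (A t + l • J) *ᵥ (V l t - V l₀ t) + (l - l₀) • (J *ᵥ V l₀ t) := by
          simp only [Matrix.mulVec_sub, Matrix.add_mulVec, Matrix.smul_mulVec, sub_smul]
          abel
        rw [e]
        refine (norm_add_le _ _).trans (add_le_add (hbd l hl t ht _) ?_)
        rw [norm_smul]
        exact mul_le_mul_of_nonneg_left (hM t ht) (norm_nonneg _)) t ht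
    linarith
  have := norm_le_of_norm_deriv_le (g := fun t => V l t - V l₀ t - (l - l₀) • Z t)
    (ε := ‖l - l₀‖ * (j * (‖l - l₀‖ * M * γ))) hκ0 le_rfl (by positivity)
    (fun t _ => (((hV l t).sub (hV l₀ t)).sub ((hZ t).const_smul (l - l₀))).hasDerivWithinAt)
    (by simp [hV0, hZ0])
    (fun t ht => by
      have e : (A t + l • J) *ᵥ V l t + g t - ((A t + l₀ • J) *ᵥ V l₀ t + g t) -
          (l - l₀) • ((A t + l₀ • J) *ᵥ Z t + J *ᵥ V l₀ t) =
          (A t + l₀ • J) *ᵥ (V l t - V l₀ t - (l - l₀) • Z t) +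
            (l - l₀) • (J *ᵥ (V l t - V l₀ t)) := by
        simp only [Matrix.mulVec_sub, Matrix.add_mulVec, Matrix.smul_mulVec, sub_smul,
          Matrix.mulVec_smul, smul_add, smul_sub]
        abel
      rw [e]
      refine (norm_add_le _ _).trans (add_le_add (hbd l₀ (by simp) t ht _) ?_)
      rw [norm_smul]
      refine mul_le_mul_of_nonneg_left ((hJle _).trans ?_) (norm_nonneg _)
      exact mul_le_mul_of_nonneg_left (hd t ht) hj0) t ht
  calc _ ≤ _ := this
    _ = _ := by ring

/-- The values and the integrals of the solutions are holomorphic in the parameter. -/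
theorem system_differentiable {A : ℝ → Matrix ι ι ℂ} (hA : Continuous A) (J : Matrix ι ι ℂ)
    {g : ℝ → ι → ℂ} {V : ℂ → ℝ → ι → ℂ} {v₀ : ι → ℂ} (hV0 : ∀ l, V l 0 = v₀)
    (hV : ∀ l t, HasDerivAt (V l) ((A t + l • J) *ᵥ V l t + g t) t) {T : ℝ} (hT : 0 ≤ T) (i : ι) :
    (Differentiable ℂ fun l => V l T i) ∧
      Differentiable ℂ fun l => ∫ x in (0 : ℝ)..T, V l x i := by
  have hVc : ∀ l, Continuous fun t => V l t i := fun l =>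
    (continuous_apply i).comp (continuous_iff_continuousAt.2 fun t => (hV l t).continuousAt)
  -- a quadratic remainder gives a derivative
  have hquad : ∀ {F : ℂ → ℂ} {F' C : ℂ} {l₀ : ℂ}, (∀ l, ‖l - l₀‖ ≤ 1 →
      ‖F l - F l₀ - (l - l₀) * F'‖ ≤ ‖C‖ * ‖l - l₀‖ ^ 2) → HasDerivAt F F' l₀ := by
    intro F F' C l₀ h
    refine hasDerivAt_iff_isLittleO.2 ?_
    have hO : (fun l => F l - F l₀ - (l - l₀) • F') =O[𝓝 l₀] fun l => ‖l - l₀‖ ^ 2 := by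
      refine IsBigO.of_bound ‖C‖ ?_
      filter_upwards [Metric.closedBall_mem_nhds l₀ one_pos] with l hl
      rw [smul_eq_mul, norm_pow, norm_norm]
      exact h l (by rwa [mem_closedBall_iff_norm] at hl)
    refine hO.trans_isLittleO ?_
    have := (isLittleO_pow_sub_sub l₀ (one_lt_two))
    simpa using this
  refine ⟨fun l₀ => ?_, fun l₀ => ?_⟩
  all_goals
    obtain ⟨Z, C, hZ, h⟩ := system_expansion hA J hV0 hV hT l₀
    have h' : ∀ l, ‖l - l₀‖ ≤ 1 → ∀ t ∈ Icc 0 T,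
        ‖V l t i - V l₀ t i - (l - l₀) * Z t i‖ ≤ C * ‖l - l₀‖ ^ 2 := fun l hl t ht =>
      (norm_le_pi_norm (V l t - V l₀ t - (l - l₀) • Z t) i).trans (h l hl t ht)
    have hZc : Continuous fun t => Z t i := (continuous_apply i).comp hZ
  · refine (hquad (F' := Z T i) (C := (C : ℂ)) fun l hl => (h' l hl T (right_mem_Icc.2 hT)).trans
      ?_).differentiableAt
    gcongr
    rw [Complex.norm_real]; exact le_abs_self C
  · refine (hquad (F' := ∫ x in (0 : ℝ)..T, Z x i) (C := ((C * T : ℝ) : ℂ))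
      fun l hl => ?_).differentiableAt
    rw [← intervalIntegral.integral_const_mul, ← intervalIntegral.integral_sub
      ((hVc l).intervalIntegrable _ _) ((hVc l₀).intervalIntegrable _ _),
      ← intervalIntegral.integral_sub (f := fun x => V l x i - V l₀ x i)
        (g := fun x => (l - l₀) * Z x i) (((hVc l).sub (hVc l₀)).intervalIntegrable _ _)
        ((continuous_const.mul hZc).intervalIntegrable _ _)]
    refine (intervalIntegral.norm_integral_le_of_norm_le_const (C := C * ‖l - l₀‖ ^ 2)
      fun x hx => ?_).trans ?_
    · rw [uIoc_of_le hT] at hx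
      exact h' l hl x (Ioc_subset_Icc_self hx)
    · rw [sub_zero, abs_of_nonneg hT, Complex.norm_real]
      calc C * ‖l - l₀‖ ^ 2 * T = C * T * ‖l - l₀‖ ^ 2 := by ring
        _ ≤ _ := by gcongr; exact le_abs_self _

end LinearSystem

end PeriodicWave

namespace PeriodicWave

variable {n : ℕ} {f : State n → State n} {B : State n → Matrix (Fin n) (Fin n) ℝ}
  {ub : ℝ → State n} {um : State n} {T : ℝ}

/-! ### The eigenvalue equation in flux variables -/

theorem cplx_mul (M N : Matrix (Fin n) (Fin n) ℝ) : cplx (M * N) = cplx M * cplx N :=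
  Matrix.map_mul (f := Complex.ofRealHom)

theorem cplx_one : cplx (1 : Matrix (Fin n) (Fin n) ℝ) = 1 :=
  Matrix.map_one _ Complex.ofReal_zero Complex.ofReal_one

theorem cplx_inv {M : Matrix (Fin n) (Fin n) ℝ} (hM : IsUnit M.det) : (cplx M)⁻¹ = cplx M⁻¹ :=
  Matrix.inv_eq_right_inv (by rw [← cplx_mul, Matrix.mul_nonsing_inv _ hM, cplx_one])

theorem det_cplx (M : Matrix (Fin n) (Fin n) ℝ) : (cplx M).det = (M.det : ℂ) :=
  (Complex.ofRealHom.map_det M).symm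

theorem continuous_cplx : Continuous (cplx : Matrix (Fin n) (Fin n) ℝ → _) :=
  continuous_id.matrix_map Complex.continuous_ofReal

/-- A real vector viewed as a complex one. -/
noncomputable def cplxVec (w : State n) : Fin n → ℂ := fun i => (w i : ℂ)

theorem cplx_mulVec (M : Matrix (Fin n) (Fin n) ℝ) (w : State n) :
    cplx M *ᵥ cplxVec w = cplxVec (M *ᵥ w) := by
  ext i
  simp [cplx, cplxVec, Matrix.mulVec, dotProduct]

theorem hasDerivWithinAt_cplxVec {g : ℝ → State n} {g' : State n} {s : Set ℝ} {t : ℝ}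
    (h : HasDerivWithinAt g g' s t) :
    HasDerivWithinAt (fun t => cplxVec (g t)) (cplxVec g') s t :=
  hasDerivWithinAt_pi.2 fun i =>
    ((hasDerivWithinAt_pi.1 h i).clm_map Complex.ofRealCLM)

/-- The coefficient matrix, at `λ = 0`, of the eigenvalue equation in the variables `(w, q)` with
`q = B w' - A w`: it reads `w' = B⁻¹ (A w + q)`, `q' = λ w`. -/
noncomputable def fluxCoeff (f : State n → State n) (B : State n → Matrix (Fin n) (Fin n) ℝ)
    (ub : ℝ → State n) (x : ℝ) : Matrix (Fin n ⊕ Fin n) (Fin n ⊕ Fin n) ℂ :=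
  Matrix.fromBlocks (cplx ((B (ub x))⁻¹ * coeffA f B ub x)) (cplx (B (ub x))⁻¹) 0 0

/-- The coefficient of `λ` in the eigenvalue equation in the variables `(w, q)`. -/
def fluxCoupling (n : ℕ) : Matrix (Fin n ⊕ Fin n) (Fin n ⊕ Fin n) ℂ :=
  Matrix.fromBlocks 0 0 1 0

/-- The change of variables from `(w, w')` to `(w, B w' - A w)`. -/
noncomputable def fluxChange (f : State n → State n) (B : State n → Matrix (Fin n) (Fin n) ℝ)
    (ub : ℝ → State n) (x : ℝ) : Matrix (Fin n ⊕ Fin n) (Fin n ⊕ Fin n) ℂ :=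
  Matrix.fromBlocks 1 0 (-cplx (coeffA f B ub x)) (cplx (B (ub x)))

theorem fluxCoeff_mulVec (l : ℂ) (x : ℝ) (w q : Fin n → ℂ) :
    (fluxCoeff f B ub x + l • fluxCoupling n) *ᵥ Sum.elim w q =
      Sum.elim (cplx ((B (ub x))⁻¹ * coeffA f B ub x) *ᵥ w + cplx (B (ub x))⁻¹ *ᵥ q) (l • w) := by
  rw [fluxCoeff, fluxCoupling, Matrix.fromBlocks_smul, Matrix.fromBlocks_add,
    Matrix.fromBlocks_mulVec]
  simp [Matrix.smul_mulVec]

theorem hasDerivAt_mul_entry {ι : Type} [Fintype ι] {M N : ℝ → Matrix ι ι ℂ} {M' N' : Matrix ι ι ℂ}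
    {x : ℝ} (hM : ∀ i j, HasDerivAt (fun y => M y i j) (M' i j) x)
    (hN : ∀ i j, HasDerivAt (fun y => N y i j) (N' i j) x) (i j : ι) :
    HasDerivAt (fun y => (M y * N y) i j) ((M' * N x + M x * N') i j) x := by
  simp only [Matrix.mul_apply, Matrix.add_apply, ← Finset.sum_add_distrib]
  exact HasDerivAt.fun_sum fun k _ => (hM i k).mul (hN k j)

namespace IsRegularWave

variable (hw : IsRegularWave f B ub um T)
include hw

theorem continuous_fluxCoeff : Continuous (fluxCoeff f B ub) :=
  (continuous_cplx.comp (hw.continuous_inv_visc.mul hw.continuous_coeffA)).matrix_fromBlocks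
    (continuous_cplx.comp hw.continuous_inv_visc) continuous_const continuous_const

theorem continuous_firstOrderCoeff (l : ℂ) : Continuous (firstOrderCoeff f B ub l) := by
  have hinv : ∀ x, (cplx (B (ub x)))⁻¹ = cplx (B (ub x))⁻¹ := fun x => cplx_inv (hw.isUnit_det x)
  have hA' : Continuous (matDeriv (coeffA f B ub)) :=
    continuous_matrix fun i j => (hw.contDiff_coeffA i j).continuous_deriv_one
  have hB' : Continuous (matDeriv fun y => B (ub y)) :=
    continuous_matrix fun i j => (hw.contDiff_visc_wave i j).continuous_deriv_one
  have hi := continuous_cplx.comp hw.continuous_inv_visc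
  unfold firstOrderCoeff
  simp only [hinv]
  exact continuous_const.matrix_fromBlocks continuous_const
    (hi.mul (continuous_const.add (continuous_cplx.comp hA')))
    (hi.mul ((continuous_cplx.comp hw.continuous_coeffA).sub (continuous_cplx.comp hB')))

theorem det_fluxChange_ne_zero (x : ℝ) : (fluxChange f B ub x).det ≠ 0 := by
  rw [fluxChange, Matrix.det_fromBlocks_zero₁₂, Matrix.det_one, one_mul, det_cplx]
  exact_mod_cast hw.det_ne_zero x

theorem fluxChange_period : fluxChange f B ub T = fluxChange f B ub 0 := by
  have h : ub T = ub 0 := by rw [← hw.periodic 0, zero_add]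
  have hd : deriv ub T = deriv ub 0 := by rw [hw.deriv_eq, hw.deriv_eq, h]
  have hA : coeffA f B ub T = coeffA f B ub 0 := by
    simp only [coeffA, h, hd]
  rw [fluxChange, fluxChange, hA, h]

theorem hasDerivAt_fluxChange (x : ℝ) (i j : Fin n ⊕ Fin n) :
    HasDerivAt (fun y => fluxChange f B ub y i j)
      ((Matrix.fromBlocks 0 0 (-cplx (matDeriv (coeffA f B ub) x))
        (cplx (matDeriv (fun y => B (ub y)) x)) : Matrix _ _ ℂ) i j) x := by
  have hA : ∀ i j, HasDerivAt (fun y => coeffA f B ub y i j)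
      (matDeriv (coeffA f B ub) x i j) x := fun i j =>
    ((hw.contDiff_coeffA i j).differentiable one_ne_zero x).hasDerivAt
  have hB : ∀ i j, HasDerivAt (fun y => B (ub y) i j)
      (matDeriv (fun y => B (ub y)) x i j) x := fun i j =>
    ((hw.contDiff_visc_wave i j).differentiable one_ne_zero x).hasDerivAt
  rcases i with i | i <;> rcases j with j | j
  · exact hasDerivAt_const x _
  · exact hasDerivAt_const x _
  · exact (hA i j).ofReal_comp.neg
  · exact (hB i j).ofReal_comp

/-- The derivative of the change of variables accounts for the difference of the two coefficient
matrices. -/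
theorem fluxChange_intertwines (l : ℂ) (x : ℝ) :
    Matrix.fromBlocks 0 0 (-cplx (matDeriv (coeffA f B ub) x))
        (cplx (matDeriv (fun y => B (ub y)) x)) +
      fluxChange f B ub x * firstOrderCoeff f B ub l x =
        (fluxCoeff f B ub x + l • fluxCoupling n) * fluxChange f B ub x := by
  have h1 : cplx (B (ub x)) * cplx (B (ub x))⁻¹ = 1 := by
    rw [← cplx_mul, Matrix.mul_nonsing_inv _ (hw.isUnit_det x), cplx_one]
  have h2 : cplx (B (ub x))⁻¹ * cplx (B (ub x)) = 1 := by
    rw [← cplx_mul, Matrix.nonsing_inv_mul _ (hw.isUnit_det x), cplx_one]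
  rw [fluxChange, firstOrderCoeff, fluxCoeff, fluxCoupling, cplx_inv (hw.isUnit_det x),
    Matrix.fromBlocks_smul, Matrix.fromBlocks_add, Matrix.fromBlocks_multiply,
    Matrix.fromBlocks_multiply, Matrix.fromBlocks_add, cplx_mul]
  simp only [← Matrix.mul_assoc, h1]
  congr 1
  · simp
  · simp [h2]
  · simp
  · simp only [zero_add, mul_one, one_mul, mul_zero, smul_zero, add_zero, zero_mul]
    abel

/-- The Evans function at `k = 0`, computed in the variables `(w, q)`. -/
theorem exists_evans_eq (l : ℂ) : ∃ Φ : ℝ → Matrix (Fin n ⊕ Fin n) (Fin n ⊕ Fin n) ℂ,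
    IsFundamental (fun x => fluxCoeff f B ub x + l • fluxCoupling n) Φ ∧
      evans f B ub T 0 l = (Φ T - 1).det := by
  obtain ⟨hΨ0, hΨd⟩ := isFundamental_fundamental (hw.continuous_firstOrderCoeff l)
  set Ψ := fundamental (firstOrderCoeff f B ub l) with hΨ
  set C := fluxChange f B ub with hC
  have hu : IsUnit (C 0).det := isUnit_iff_ne_zero.2 (hw.det_fluxChange_ne_zero 0)
  refine ⟨fun x => C x * Ψ x * (C 0)⁻¹, ⟨?_, fun x i j => ?_⟩, ?_⟩
  · simp only
    rw [hΨ0, mul_one, Matrix.mul_nonsing_inv _ hu]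
  · have h := hasDerivAt_mul_entry (hasDerivAt_mul_entry (hw.hasDerivAt_fluxChange x) (hΨd x))
      (N := fun _ => (C 0)⁻¹) (N' := 0) (fun i j => hasDerivAt_const x _) i j
    refine h.congr_deriv ?_
    rw [mul_zero, add_zero, ← Matrix.mul_assoc (fluxChange f B ub x), ← Matrix.add_mul,
      hw.fluxChange_intertwines]
    simp only [Matrix.mul_assoc, hC, hΨ]
  · have hk : Complex.exp (Complex.I * (0 : ℝ) * T) • (1 : Matrix (Fin n ⊕ Fin n) (Fin n ⊕ Fin n) ℂ)
        = 1 := by simp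
    have e : C T * Ψ T * (C 0)⁻¹ - 1 = C 0 * (Ψ T - 1) * (C 0)⁻¹ := by
      rw [hC, hw.fluxChange_period, ← hC, Matrix.mul_sub, Matrix.sub_mul, mul_one,
        Matrix.mul_nonsing_inv _ hu]
    simp only [e]
    rw [evans, hk, monodromy, Matrix.det_conj ((Matrix.isUnit_iff_isUnit_det _).2 hu)]

end IsRegularWave

end PeriodicWave

namespace PeriodicWave

variable {n : ℕ} {f : State n → State n} {B : State n → Matrix (Fin n) (Fin n) ℝ}
  {ub : ℝ → State n} {um : State n} {T : ℝ}

/-! ### Solutions of the eigenvalue equation that continue the variations -/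

/-- The flux `q = B w' - A w` of the variation `w` of the profile in the direction `h` of the
parameters `(u₋, u₀, s)`. -/
noncomputable def variationFlux (f : State n → State n) (ub : ℝ → State n) (um : State n)
    (h : Param n) (t : ℝ) : State n :=
  -(jacobian f um *ᵥ h.1) - h.2.2 • (ub t - um)

theorem cplxVec_add (v w : State n) : cplxVec (v + w) = cplxVec v + cplxVec w := by
  ext i; simp [cplxVec]

theorem cplxVec_zero : cplxVec (0 : State n) = 0 := by
  ext i; simp [cplxVec]

/-- `V l` solves `w' = B⁻¹ (A w + q)`, `q' = l w - s ū'`, and for `l = 0` it is the variation in the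
direction `h = (·, ·, s)` of the parameters, together with its flux. -/
structure IsContinuation (f : State n → State n) (B : State n → Matrix (Fin n) (Fin n) ℝ)
    (ub : ℝ → State n) (um : State n) (h : Param n) (V : ℂ → ℝ → Fin n ⊕ Fin n → ℂ) : Prop where
  apply_zero : ∀ l, V l 0 = Sum.elim (cplxVec h.2.1) (cplxVec (variationFlux f ub um h 0))
  hasDerivAt : ∀ l t, HasDerivAt (V l) ((fluxCoeff f B ub t + l • fluxCoupling n) *ᵥ V l t +
    Sum.elim (0 : Fin n → ℂ) (cplxVec (-h.2.2 • deriv ub t))) t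

theorem hasDerivWithinAt_sumElim {w q : ℝ → Fin n → ℂ} {w' q' : Fin n → ℂ} {s : Set ℝ} {t : ℝ}
    (hw : HasDerivWithinAt w w' s t) (hq : HasDerivWithinAt q q' s t) :
    HasDerivWithinAt (fun t => Sum.elim (w t) (q t)) (Sum.elim w' q') s t := by
  rw [hasDerivWithinAt_pi]
  rintro (i | i)
  · exact hasDerivWithinAt_pi.1 hw i
  · exact hasDerivWithinAt_pi.1 hq i

namespace IsRegularWave

variable (hw : IsRegularWave f B ub um T)
include hw

theorem continuous_source (s : ℝ) :
    Continuous fun t => (Sum.elim 0 (cplxVec (s • deriv ub t)) : Fin n ⊕ Fin n → ℂ) := by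
  refine continuous_pi ?_
  rintro (i | i)
  · exact continuous_const
  · exact Complex.continuous_ofReal.comp
      ((continuous_apply i).comp (hw.contDiff_deriv.continuous.const_smul s))

theorem exists_isContinuation (h : Param n) : ∃ V, IsContinuation f B ub um h V := by
  choose V hV0 hV using fun l : ℂ => exists_system_solution
    (hw.continuous_fluxCoeff.add (continuous_const (y := l • fluxCoupling n)))
    (hw.continuous_source (-h.2.2))
    (Sum.elim (cplxVec h.2.1) (cplxVec (variationFlux f ub um h 0)))
  exact ⟨V, hV0, hV⟩

end IsRegularWave

namespace IsContinuation

variable {h : Param n} {V : ℂ → ℝ → Fin n ⊕ Fin n → ℂ} (hV : IsContinuation f B ub um h V)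
  (hw : IsRegularWave f B ub um T)
include hV hw

theorem eq_variation {ω : ℝ → Param n →L[ℝ] State n} (hω : IsVariation f B ub um T ω) {t : ℝ}
    (ht : t ∈ Icc 0 T) :
    V 0 t = Sum.elim (cplxVec (ω t h)) (cplxVec (variationFlux f ub um h t)) := by
  refine linear_solution_unique_Icc (u := V 0)
    (v := fun t => Sum.elim (cplxVec (ω t h)) (cplxVec (variationFlux f ub um h t)))
    (continuous_mulVecReal hw.continuous_fluxCoeff)
    (fun t _ => ((hV.hasDerivAt 0 t).congr_deriv ?_).hasDerivWithinAt) (fun t ht => ?_) ?_ ht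
    (c := fun t => Sum.elim (0 : Fin n → ℂ) (cplxVec (-h.2.2 • deriv ub t)))
  · simp
  · have hq : HasDerivWithinAt (variationFlux f ub um h) (-h.2.2 • deriv ub t) (Icc 0 T) t := by
      have := (((hw.hasDerivAt t).sub_const um).const_smul h.2.2).const_sub
        (-(jacobian f um *ᵥ h.1))
      rw [← hw.deriv_eq] at this
      exact (this.congr_deriv (by simp)).hasDerivWithinAt
    refine (hasDerivWithinAt_sumElim (hasDerivWithinAt_cplxVec (hω.hasDerivWithinAt t ht h))
      (hasDerivWithinAt_cplxVec hq)).congr_deriv ?_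
    have e := fluxCoeff_mulVec (f := f) (B := B) (ub := ub) 0 t (cplxVec (ω t h))
      (cplxVec (variationFlux f ub um h t))
    rw [zero_smul, zero_smul, add_zero] at e
    rw [mulVecReal_apply, e, cplx_mulVec, cplx_mulVec, ← cplxVec_add, ← Matrix.mulVec_mulVec,
      ← Matrix.mulVec_add, variationFlux]
    ext (i | i)
    · simp [sub_eq_add_neg, add_assoc]
    · simp
  · rw [hV.apply_zero, hω.apply_zero]

/-- The `q`-component changes over a period by `l` times the integral of the `w`-component, since
the source is the derivative of a periodic function. -/
theorem jump_flux (l : ℂ) (i : Fin n) :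
    V l T (Sum.inr i) - V l 0 (Sum.inr i) = l * ∫ x in (0 : ℝ)..T, V l x (Sum.inl i) := by
  have hVc : Continuous (V l) := continuous_iff_continuousAt.2 fun t =>
    (hV.hasDerivAt l t).continuousAt
  have hVi : Continuous fun x => l * V l x (Sum.inl i) :=
    continuous_const.mul ((continuous_apply _).comp hVc)
  have hd : ∀ t, HasDerivAt (fun t => V l t (Sum.inr i) + (h.2.2 : ℂ) * (ub t i : ℂ))
      (l * V l t (Sum.inl i)) t := by
    intro t
    have h1 := hasDerivAt_pi.1 (hV.hasDerivAt l t) (Sum.inr i)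
    have h2 := ((hasDerivAt_pi.1 (hw.hasDerivAt t) i).ofReal_comp).const_mul (h.2.2 : ℂ)
    rw [← hw.deriv_eq] at h2
    refine (h1.add h2).congr_deriv ?_
    have hsplit : V l t = Sum.elim (fun i => V l t (Sum.inl i)) (fun i => V l t (Sum.inr i)) := by
      ext (i | i) <;> rfl
    rw [hsplit, Pi.add_apply, fluxCoeff_mulVec]
    simp [cplxVec]
  have := intervalIntegral.integral_eq_sub_of_hasDerivAt (a := 0) (b := T) (fun t _ => hd t)
    (hVi.intervalIntegrable _ _)
  rw [← intervalIntegral.integral_const_mul, this, ← hw.periodic 0, zero_add]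
  ring

omit hw in
/-- If `h` leaves the speed unchanged, the continuation solves the eigenvalue equation. -/
theorem hasDerivAt_of_speed_eq_zero (hs : h.2.2 = 0) (l : ℂ) (t : ℝ) :
    HasDerivAt (V l) ((fluxCoeff f B ub t + l • fluxCoupling n) *ᵥ V l t) t := by
  refine (hV.hasDerivAt l t).congr_deriv ?_
  rw [hs, neg_zero, zero_smul, cplxVec_zero]
  ext (i | i) <;> simp

/-- For the direction `s = -1`, the function `ū' + l V` solves the eigenvalue equation. -/
theorem hasDerivAt_of_speed_eq_neg_one (hs : h.2.2 = -1) (l : ℂ) (t : ℝ) :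
    HasDerivAt (fun t => Sum.elim (cplxVec (deriv ub t)) 0 + l • V l t)
      ((fluxCoeff f B ub t + l • fluxCoupling n) *ᵥ
        (Sum.elim (cplxVec (deriv ub t)) 0 + l • V l t)) t := by
  have h1 := hasDerivWithinAt_sumElim (hasDerivWithinAt_cplxVec
    (hw.hasDerivAt_deriv t).hasDerivWithinAt) (hasDerivWithinAt_const t univ (0 : Fin n → ℂ))
  rw [hasDerivWithinAt_univ] at h1
  refine (h1.add ((hV.hasDerivAt l t).const_smul l)).congr_deriv ?_
  rw [Matrix.mulVec_add, fluxCoeff_mulVec, Matrix.mulVec_smul, smul_add, hs, cplx_mulVec,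
    ← Matrix.mulVec_mulVec]
  ext (i | i)
  · simp
  · simp [cplxVec]; ring

end IsContinuation

/-! ### The Evans function near the origin -/

section Evans

variable [NeZero n]

/-- The directions in the parameters `(u₋, u₀, s)` whose variations are `z̃₁, w₂, …, wₙ` and
`wₙ₊₁, …, w₂ₙ`. -/
noncomputable def direction (b : Module.Basis (Fin n) ℝ (State n)) : Fin n ⊕ Fin n → Param n :=
  Sum.elim (fun k => if k = 0 then (0, 0, -1) else (0, b k, 0)) fun j => (Pi.single j 1, 0, 0)

/-- The jumps of the `w`-components of functions on `[0, T]`, above the integrals of these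
components. -/
noncomputable def jumpIntegralMatrix (T : ℝ)
    (V : Fin n ⊕ Fin n → ℝ → Fin n ⊕ Fin n → ℂ) : Matrix (Fin n ⊕ Fin n) (Fin n ⊕ Fin n) ℂ :=
  Matrix.of fun r c => Sum.elim (fun i => V c T (Sum.inl i) - V c 0 (Sum.inl i))
    (fun i => ∫ x in (0 : ℝ)..T, V c x (Sum.inl i)) r

variable (hw : IsRegularWave f B ub um T)
  {b : Module.Basis (Fin n) ℝ (State n)} (hb : b 0 = deriv ub 0)
  {V : Fin n ⊕ Fin n → ℂ → ℝ → Fin n ⊕ Fin n → ℂ}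
  (hV : ∀ c, IsContinuation f B ub um (direction b c) (V c))
include hw hb hV

/-- The factorization of the Evans function. The factor `l ^ (n + 1)` has one power from the column
`ū' + l V`, whose leading term is periodic, and `n` powers from the jumps of the fluxes. -/
theorem evans_mul_det (l : ℂ) :
    evans f B ub T 0 l *
      ((((Pi.basisFun ℝ (Fin n)).toMatrix b).det * ((-1) ^ n * (jacobian f um).det) : ℝ) : ℂ) =
      l ^ (n + 1) * (jumpIntegralMatrix T fun c => V c l).det := by
  obtain ⟨Φ, hΦ, hev⟩ := hw.exists_evans_eq l
  have hcont := hw.continuous_fluxCoeff.add (continuous_const (y := l • fluxCoupling n))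
  -- the columns of the solution matrix
  set Y : Fin n ⊕ Fin n → ℝ → Fin n ⊕ Fin n → ℂ := fun c t =>
    if c = Sum.inl 0 then Sum.elim (cplxVec (deriv ub t)) 0 + l • V c l t else V c l t with hY
  have hYd : ∀ c t, HasDerivAt (Y c) ((fluxCoeff f B ub t + l • fluxCoupling n) *ᵥ Y c t) t := by
    intro c t
    by_cases hc : c = Sum.inl 0
    · simp only [hY, hc, if_true]
      exact (hV _).hasDerivAt_of_speed_eq_neg_one hw (by simp [direction]) l t
    · simp only [hY, if_neg hc]
      refine (hV c).hasDerivAt_of_speed_eq_zero ?_ l t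
      rcases c with k | j
      · have : k ≠ 0 := fun h => hc (by rw [h])
        simp [direction, this]
      · simp [direction]
  set d : Fin n ⊕ Fin n → ℂ := Sum.elim (fun k => if k = 0 then l else 1) 1 with hd
  have hfactor : (Φ T - 1) * Matrix.of (fun r c => Y c 0 r) =
      Matrix.diagonal (Sum.elim 1 fun _ => l) * (jumpIntegralMatrix T fun c => V c l) *
        Matrix.diagonal d := by
    ext r c
    have h1 : ((Φ T - 1) * Matrix.of (fun r c => Y c 0 r)) r c = Y c T r - Y c 0 r := by
      rw [hΦ.mulVec_eq hcont (hYd c) T, Matrix.sub_mul, one_mul]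
      rfl
    have h2 : Y c T r - Y c 0 r = d c * (V c l T r - V c l 0 r) := by
      by_cases hc : c = Sum.inl 0
      · simp only [hY, hc, if_true, hw.deriv_period, hd, Sum.elim_inl, Pi.add_apply, Pi.smul_apply,
          smul_eq_mul]
        ring
      · have : d c = 1 := by
          rcases c with k | j
          · have : k ≠ 0 := fun h => hc (by rw [h])
            simp [hd, this]
          · simp [hd]
        simp [hY, hc, this]
    rw [h1, h2, Matrix.mul_diagonal, Matrix.diagonal_mul, mul_comm]
    congr 1
    rcases r with i | i
    · simp [jumpIntegralMatrix]
    · simpa [jumpIntegralMatrix] using (hV c).jump_flux hw l i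
  have hinit : (Matrix.of fun r c => Y c 0 r : Matrix (Fin n ⊕ Fin n) (Fin n ⊕ Fin n) ℂ) =
      Matrix.fromBlocks (cplx ((Pi.basisFun ℝ (Fin n)).toMatrix b)) 0
        (Matrix.of fun i k => Y (Sum.inl k) 0 (Sum.inr i)) (cplx (-jacobian f um)) := by
    ext (i | i) (k | j)
    · by_cases hk : k = 0
      · simp [hY, hk, (hV _).apply_zero, direction, cplxVec, cplx, Module.Basis.toMatrix_apply, hb]
      · simp [hY, hk, (hV _).apply_zero, direction, cplxVec, cplx, Module.Basis.toMatrix_apply]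
    · simp [hY, (hV _).apply_zero, direction, cplxVec]
    · rfl
    · simp [hY, (hV _).apply_zero, direction, cplxVec, cplx, variationFlux]
  have := congrArg Matrix.det hfactor
  rw [Matrix.det_mul, hinit, Matrix.det_fromBlocks_zero₁₂, det_cplx, det_cplx, Matrix.det_neg,
    Fintype.card_fin, Matrix.det_mul, Matrix.det_mul, Matrix.det_diagonal, Matrix.det_diagonal,
    Fintype.prod_sum_type, Fintype.prod_sum_type, ← hev] at this
  simp only [hd, Sum.elim_inl, Sum.elim_inr, Pi.one_apply, Finset.prod_const_one, one_mul,
    mul_one, Finset.prod_const, Finset.card_univ, Fintype.card_fin, Finset.prod_ite_eq',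
    Finset.mem_univ, if_true] at this
  push_cast at this ⊢
  rw [this]
  ring

omit hb in
theorem differentiable_det_jumpIntegralMatrix :
    Differentiable ℂ fun l => (jumpIntegralMatrix T fun c => V c l).det := by
  have hent : ∀ r c, Differentiable ℂ fun l => (jumpIntegralMatrix T fun c => V c l) r c := by
    intro r c
    have := system_differentiable hw.continuous_fluxCoeff (fluxCoupling n) (hV c).apply_zero
      (hV c).hasDerivAt hw.pos.le
    rcases r with i | i
    · have h0 : ∀ l, V c l 0 (Sum.inl i) = V c 0 0 (Sum.inl i) := fun l => by
        rw [(hV c).apply_zero, (hV c).apply_zero]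
      simp only [jumpIntegralMatrix, Matrix.of_apply, Sum.elim_inl, h0]
      exact (this (Sum.inl i)).1.sub_const _
    · exact (this (Sum.inl i)).2
  simp only [Matrix.det_apply]
  exact Differentiable.fun_sum fun σ _ =>
    (Differentiable.fun_finsetProd fun i _ => hent _ _).const_smul _

omit hb in
/-- At `l = 0` the determinant is computed by eliminating the jumps of `wₙ₊₁, …, w₂ₙ`. -/
theorem det_jumpIntegralMatrix_zero {ω : ℝ → Param n →L[ℝ] State n}
    (hω : IsVariation f B ub um T ω) (hγ : gammaCoeff f B T um (ub 0) b ≠ 0) :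
    (jumpIntegralMatrix T fun c => V c 0).det =
      ((((Pi.basisFun ℝ (Fin n)).toMatrix b).det * gammaCoeff f B T um (ub 0) b *
        deltaCoeff f B T um (ub 0) b : ℝ) : ℂ) := by
  have hT := hw.pos.le
  have h0 := left_mem_Icc.2 hT
  have h1 := right_mem_Icc.2 hT
  set P := transverseMatrix f B T um (ub 0) b with hP
  have hdet : IsUnit P.det := isUnit_det_transverseMatrix hγ
  have htrans : ∀ {t}, t ∈ Icc 0 T → ∀ k,
      ω t (direction b (Sum.inl k)) = transverse f B T um (ub 0) b k t := by
    intro t ht k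
    rw [hω.transverse_eq ht, direction, Sum.elim_inl]
    split_ifs
    · rw [← map_neg]; simp
    · rfl
  have hrest : ∀ {t}, t ∈ Icc 0 T → ∀ j,
      ω t (direction b (Sum.inr j)) = varRest f B T um (ub 0) (Pi.single j 1) t := fun ht j =>
    (hω.varRest_eq ht _).symm
  set Q : Matrix (Fin n) (Fin n) ℝ := Matrix.of fun i j =>
    jump T (varRest f B T um (ub 0) (Pi.single j 1)) i with hQ
  set S : Matrix (Fin n) (Fin n) ℝ := Matrix.of fun i k =>
    ∫ x in (0 : ℝ)..T, ω x (direction b (Sum.inl k)) i with hS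
  set U : Matrix (Fin n) (Fin n) ℝ := Matrix.of fun i j =>
    ∫ x in (0 : ℝ)..T, ω x (direction b (Sum.inr j)) i with hU
  have hVω : ∀ {t}, t ∈ Icc 0 T → ∀ c i,
      V c 0 t (Sum.inl i) = (ω t (direction b c) i : ℂ) := fun ht c i => by
    rw [(hV c).eq_variation hw hω ht]; rfl
  have hmat : (jumpIntegralMatrix T fun c => V c 0) =
      (Matrix.fromBlocks P Q S U).map Complex.ofRealHom := by
    have hint : ∀ c i, ∫ x in (0 : ℝ)..T, V c 0 x (Sum.inl i) =
        ((∫ x in (0 : ℝ)..T, ω x (direction b c) i : ℝ) : ℂ) := fun c i => by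
      rw [← intervalIntegral.integral_ofReal]
      refine intervalIntegral.integral_congr fun x hx => ?_
      rw [uIcc_of_le hT] at hx
      exact hVω hx c i
    ext (i | i) (k | j)
    · simp [jumpIntegralMatrix, hVω h0, hVω h1, htrans h0, htrans h1, hP, transverseMatrix, jump]
    · simp [jumpIntegralMatrix, hVω h0, hVω h1, hrest h0, hrest h1, hQ, jump]
    · exact hint _ i
    · exact hint _ i
  have hi : ∀ h i, IntervalIntegrable (fun x => ω x h i) MeasureTheory.volume 0 T := fun h i =>
    ContinuousOn.intervalIntegrable (by
      rw [uIcc_of_le hT]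
      exact (continuous_apply i).comp_continuousOn (hω.continuousOn_apply h))
  have hschur : (U - S * P⁻¹ * Q).det = deltaCoeff f B T um (ub 0) b := by
    rw [deltaCoeff]
    congr 1
    ext i j
    have hadj : ∀ x ∈ Icc 0 T, adjusted f B T um (ub 0) b j x =
        ω x (direction b (Sum.inr j)) - ∑ k, (P⁻¹ * Q) k j • ω x (direction b (Sum.inl k)) := by
      intro x hx
      rw [adjusted, hrest hx]
      congr 1
      refine Finset.sum_congr rfl fun k _ => ?_
      rw [htrans hx]
      rfl
    have hadjc : ContinuousOn (fun x => ω x (direction b (Sum.inr j)) -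
        ∑ k, (P⁻¹ * Q) k j • ω x (direction b (Sum.inl k))) (Icc 0 T) :=
      (hω.continuousOn_apply _).sub (continuousOn_finsetSum _ fun k _ =>
        by have := hω.continuousOn_apply (direction b (Sum.inl k)); fun_prop)
    have hcongr : ∫ x in (0 : ℝ)..T, adjusted f B T um (ub 0) b j x =
        ∫ x in (0 : ℝ)..T, (ω x (direction b (Sum.inr j)) -
          ∑ k, (P⁻¹ * Q) k j • ω x (direction b (Sum.inl k))) :=
      intervalIntegral.integral_congr fun x hx => hadj x (by rwa [uIcc_of_le hT] at hx)
    have hproj := (ContinuousLinearMap.proj (R := ℝ) (φ := fun _ : Fin n => ℝ)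
      i).intervalIntegral_comp_comm (hadjc.intervalIntegrable_of_Icc (μ := MeasureTheory.volume) hT)
    rw [Matrix.of_apply, hcongr]
    refine Eq.trans ?_ hproj
    simp only [map_sub, map_sum, map_smul, ContinuousLinearMap.proj_apply, smul_eq_mul]
    have hsum : IntervalIntegrable
        (fun x => ∑ k, (P⁻¹ * Q) k j * ω x (direction b (Sum.inl k)) i)
        MeasureTheory.volume 0 T := by
      have := IntervalIntegrable.sum Finset.univ fun k (_ : k ∈ Finset.univ) =>
        (hi (direction b (Sum.inl k)) i).const_mul ((P⁻¹ * Q) k j)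
      convert! this using 1
      ext x
      rw [Finset.sum_apply]
    rw [intervalIntegral.integral_sub (hi _ _) hsum,
      intervalIntegral.integral_finsetSum fun k _ => (hi _ _).const_mul _]
    rw [Matrix.mul_assoc, Matrix.sub_apply, Matrix.mul_apply (M := S)]
    simp only [intervalIntegral.integral_const_mul]
    exact congrArg₂ _ rfl (Finset.sum_congr rfl fun k _ => mul_comm _ _)
  have hPinv : Invertible P := Matrix.invertibleOfIsUnitDet P hdet
  rw [hmat, ← RingHom.mapMatrix_apply, ← RingHom.map_det, Matrix.det_fromBlocks₁₁,
    Matrix.invOf_eq_nonsing_inv, hschur, hP, det_transverseMatrix]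
  rfl

end Evans

end PeriodicWave

/-- A function with the factor `l ^ m` in front of a holomorphic one has its first possibly nonzero
Taylor coefficient in degree `m`. -/
theorem iteratedDeriv_pow_mul_zero {h : ℂ → ℂ} (hh : Differentiable ℂ h) (m k : ℕ) (hk : k ≤ m) :
    iteratedDeriv k (fun l => l ^ m * h l) 0 = if k = m then (m.factorial : ℂ) * h 0 else 0 := by
  rw [iteratedDeriv_fun_mul (f := fun l : ℂ => l ^ m) (contDiff_id.pow m).contDiffAt
    hh.contDiff.contDiffAt]
  simp only [iteratedDeriv_fun_pow_zero]
  rw [Finset.sum_eq_single k]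
  · by_cases h : k = m <;> simp [h]
  · intro i hi hik
    have : i ≠ m := by
      have := Finset.mem_range.1 hi
      omega
    simp [this]
  · simp

theorem proposition5p2 {n : ℕ} [NeZero n]
    (f : PeriodicWave.State n → PeriodicWave.State n)
    (B : PeriodicWave.State n → Matrix (Fin n) (Fin n) ℝ)
    (ub : ℝ → PeriodicWave.State n) (um : PeriodicWave.State n) (T : ℝ)
    (hT : 0 < T) (hper : Function.Periodic ub T)
    (hode : ∀ x, HasDerivAt ub (PeriodicWave.field f B um 0 (ub x)) x)
    (H0f : ContDiff ℝ 2 f)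
    (H0B : ∀ i j, ContDiff ℝ 2 fun u => B u i j)
    (H1 : ∀ x, ∀ μ ∈ spectrum ℂ (PeriodicWave.cplx (B (ub x))), 0 < μ.re)
    (H2 : IsUnit (PeriodicWave.jacobian f um))
    (H3 : PeriodicWave.Transversal f B T um (ub 0))
    (b : Module.Basis (Fin n) ℝ (PeriodicWave.State n)) (hb : b 0 = deriv ub 0) :
    PeriodicWave.gammaCoeff f B T um (ub 0) b ≠ 0 ∧
    (∃ σ, PeriodicWave.IsPeriodicFamily f B T um (ub 0) b σ) ∧
    (∀ σ, PeriodicWave.IsPeriodicFamily f B T um (ub 0) b σ →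
      DifferentiableAt ℝ (PeriodicWave.mass f B T σ) um ∧
      (PeriodicWave.jacobian (PeriodicWave.mass f B T σ) um).det =
        PeriodicWave.deltaCoeff f B T um (ub 0) b) ∧
    ((fun l : ℂ => PeriodicWave.evans f B ub T 0 l -
        l ^ (n + 1) * (PeriodicWave.leadingCoeff f B T um (ub 0) b : ℂ))
      =O[𝓝 0] fun l : ℂ => l ^ (n + 2)) ∧
    AnalyticAt ℂ (PeriodicWave.evans f B ub T 0) 0 ∧
    (∀ k ≤ n, iteratedDeriv k (PeriodicWave.evans f B ub T 0) 0 = 0) ∧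
    iteratedDeriv (n + 1) (PeriodicWave.evans f B ub T 0) 0 =
      ((n + 1).factorial : ℂ) * (PeriodicWave.leadingCoeff f B T um (ub 0) b : ℂ) := by
  have hw : PeriodicWave.IsRegularWave f B ub um T :=
    ⟨hT, hper, hode, H0f, H0B, fun x hx => by
      refine (H1 x 0 ?_).ne' rfl
      rw [spectrum.zero_mem_iff, Matrix.isUnit_iff_isUnit_det, PeriodicWave.det_cplx, hx]
      simp⟩
  obtain ⟨ω, hω⟩ := hw.exists_isVariation
  have hγ := hω.gammaCoeff_ne_zero hw hb H3
  obtain ⟨ψ, -, hψ, -⟩ := hω.exists_family hw hb hγ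
  choose V hV using fun c => hw.exists_isContinuation (PeriodicWave.direction b c)
  set κ : ℝ := ((Pi.basisFun ℝ (Fin n)).toMatrix b).det *
    ((-1) ^ n * (PeriodicWave.jacobian f um).det) with hκ
  have hdet := PeriodicWave.det_basis_ne_zero b
  have hjac : (PeriodicWave.jacobian f um).det ≠ 0 :=
    ((Matrix.isUnit_iff_isUnit_det _).1 H2).ne_zero
  have hκ0 : κ ≠ 0 := mul_ne_zero hdet (mul_ne_zero (pow_ne_zero _ (by norm_num)) hjac)
  have hκ0' : (κ : ℂ) ≠ 0 := by exact_mod_cast hκ0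
  -- the Evans function is `l ^ (n + 1)` times the entire function `h`
  set h : ℂ → ℂ := fun l => (PeriodicWave.jumpIntegralMatrix T fun c => V c l).det / κ with hh
  have hhd : Differentiable ℂ h :=
    (PeriodicWave.differentiable_det_jumpIntegralMatrix hw hV).div_const _
  have hev : PeriodicWave.evans f B ub T 0 = fun l => l ^ (n + 1) * h l := by
    funext l
    rw [hh, ← mul_div_assoc, ← PeriodicWave.evans_mul_det hw hb hV l, mul_div_cancel_right₀ _ hκ0']
  have hh0 : h 0 = (PeriodicWave.leadingCoeff f B T um (ub 0) b : ℂ) := by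
    simp only [hh]
    rw [PeriodicWave.det_jumpIntegralMatrix_zero hw hV hω hγ, ← Complex.ofReal_div]
    congr 1
    rw [PeriodicWave.leadingCoeff, Matrix.det_nonsing_inv, Ring.inverse_eq_inv', hκ]
    have hsign : ((-1 : ℝ) ^ n) * (-1) ^ n = 1 := by rw [← mul_pow]; simp
    field_simp
    linear_combination (-PeriodicWave.deltaCoeff f B T um (ub 0) b) * hsign
  refine ⟨hγ, ⟨ψ, hψ⟩, fun σ hσ => hω.mass_family hw hb hγ hσ, ?_, ?_, fun k hk => ?_, ?_⟩
  · have hO : (fun l => h l - h 0) =O[𝓝 0] fun l => l := by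
      simpa using (hhd 0).isBigO_sub
    have := (isBigO_refl (fun l : ℂ => l ^ (n + 1)) (𝓝 0)).mul hO
    refine this.congr (fun l => ?_) fun l => ?_
    · rw [hev, ← hh0]; ring
    · ring
  · rw [hev]
    exact ((differentiable_id.pow (n + 1)).mul hhd).analyticAt 0
  · rw [hev, iteratedDeriv_pow_mul_zero hhd _ _ (by omega), if_neg (by omega)]
  · rw [hev, iteratedDeriv_pow_mul_zero hhd _ _ le_rfl, if_pos rfl, hh0]
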